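/- Let $\mathcal N\subset B(H)$ be a von Neumann algebra on a complex Hilbert space $H$ with a fixed faithful normal semi-finite trace $\tau$. For $A\in\mathcal N$ and $t\ge 0$ let $\mu(t,A)=\inf\{\|Ap\|: p\in\mathcal N \text{ a projection},\ \tau(1-p)\le t\}$, let $$\mathcal M_{1,\infty}=\Big\{A\in\mathcal N:\ \sup_{t>0}\frac1{\log(1+t)}\int_0^t\mu(s,A)\,ds<\infty\Big\},$$ let $\mathcal M_{1,\infty}^+$ be the set of positive operators in $\mathcal M_{1,\infty}$, and write $B\prec\prec A$ if $\int_0^t\mu(s,B)\,ds\le\int_0^t\mu(s,A)\,ds$ for all $t\ge0$. Let $L_\infty(0,\infty)$ be the space of bounded Lebesgue measurable real functions on $(0,\infty)$, and let $\gamma:L_\infty(0,\infty)\to\mathbb R$ be a generalised limit, that is, a linear functional with $\gamma(z)\ge0$ for $z\ge0$, $\gamma(1)=1$, and $\gamma(z)=0$ whenever $\lim_{t\to\infty}z(t)=0$. For every $A\in\mathcal M_{1,\infty}^+$ the function $t\mapsto\frac1t\tau(A^{1+1/t})$ is finite on $(0,\infty)$ and agrees for all large $t$ with an element of $L_\infty(0,\infty)$;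 the number $$\zeta_\gamma(A)=\gamma\Big(\frac1t\tau(A^{1+1/t})\Big)$$ is defined as the value of $\gamma$ at any such element (for instance at the function cut off to $[1,\infty)$), and does not depend on its choice. Moreover $\mathcal M_{1,\infty}$ is a linear subspace of $\mathcal N$ that contains $\Re(A)_\pm$ and $\Im(A)_\pm$ for each of its elements $A$, where $\Re(A)=\frac12(A+A^*)$, $\Im(A)=\frac1{2i}(A-A^*)$ and $B_+$, $B_-\ge0$ are the positive and negative parts of a self-adjoint operator $B=B_+-B_-$. Put, for $A\in\mathcal M_{1,\infty}$, $$\zeta_\gamma(A)=\big(\zeta_\gamma(\Re(A)_+)-\zeta_\gamma(\Re(A)_-)\big)+i\big(\zeta_\gamma(\Im(A)_+)-\zeta_\gamma(\Im(A)_-)\big).$$ Then $\zeta_\gamma$ is a linear functional $\mathcal M_{1,\infty}\to\mathbb C$, and it is fully symmetric: $\zeta_\gamma(B)\le\zeta_\gamma(A)$ (both numbers being real) for all $A,B\in\mathcal M_{1,\infty}^+$ with $B\prec\prec A$. -/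

import Mathlib

open MeasureTheory Set Filter Topology
open scoped ENNReal ComplexStarModule ComplexOrder

noncomputable section

namespace ZetaFunctional

/-- `L_∞(0,∞)`: all bounded Lebesgue measurable real functions on the semi-axis. A real function is
Lebesgue measurable if and only if it is almost everywhere equal to a Borel function. -/
def LInfty : Submodule ℝ (Ioi (0 : ℝ) → ℝ) where
  carrier := {z | AEMeasurable z (Measure.comap Subtype.val volume) ∧ ∃ C : ℝ, ∀ t, |z t| ≤ C}
  add_mem' := by
    rintro a b ⟨ha, C, hC⟩ ⟨hb, D, hD⟩
    exact ⟨ha.add hb, C + D, fun t => (abs_add_le _ _).trans (add_le_add (hC t) (hD t))⟩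
  zero_mem' := ⟨aemeasurable_const, 0, fun t => by simp⟩
  smul_mem' := by
    rintro c a ⟨ha, C, hC⟩
    refine ⟨ha.const_smul c, |c| * C, fun t => ?_⟩
    simp only [Pi.smul_apply, smul_eq_mul, abs_mul]
    exact mul_le_mul_of_nonneg_left (hC t) (abs_nonneg c)

/-- The constant function one as an element of `L_∞(0,∞)`. -/
def LInfty.one : LInfty := ⟨fun _ => 1, aemeasurable_const, 1, fun t => by simp⟩

/-- Generalised limits: positive normalised linear functionals on `L_∞(0,∞)` that vanish on all
functions tending to zero at infinity. -/
structure IsGeneralisedLimit (γ : LInfty →ₗ[ℝ] ℝ) : Prop where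
  nonneg : ∀ z : LInfty, (∀ t, 0 ≤ z.1 t) → 0 ≤ γ z
  normalised : γ LInfty.one = 1
  vanish : ∀ z : LInfty, Tendsto z.1 atTop (𝓝 0) → γ z = 0

variable {H : Type*} [NormedAddCommGroup H] [InnerProductSpace ℂ H] [CompleteSpace H]

/-- `τ` is a faithful normal semi-finite trace on the von Neumann algebra `N`. A trace is a function
on the positive cone of `N`; the values of `τ` outside this cone play no role. -/
structure IsFaithfulNormalSemifiniteTrace (N : VonNeumannAlgebra H)
    (τ : (H →L[ℂ] H) → ℝ≥0∞) : Prop where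
  map_add : ∀ A ∈ N, ∀ B ∈ N, 0 ≤ A → 0 ≤ B → τ (A + B) = τ A + τ B
  map_smul : ∀ c : ℝ, 0 ≤ c → ∀ A ∈ N, 0 ≤ A → τ (c • A) = ENNReal.ofReal c * τ A
  tracial : ∀ A ∈ N, τ (star A * A) = τ (A * star A)
  faithful : ∀ A ∈ N, 0 ≤ A → τ A = 0 → A = 0
  normal : ∀ S : Set (H →L[ℂ] H), S ⊆ N → (∀ B ∈ S, 0 ≤ B) → S.Nonempty →
    DirectedOn (· ≤ ·) S → ∀ A ∈ N, IsLUB S A → IsLUB (τ '' S) (τ A)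
  semifinite : ∀ A ∈ N, 0 ≤ A → A ≠ 0 → ∃ B ∈ N, 0 ≤ B ∧ B ≤ A ∧ B ≠ 0 ∧ τ B < ∞

/-- The generalised singular value function
`μ(t, A) = inf {‖A p‖ : p a projection in N with τ(1 - p) ≤ t}`, for `t ≥ 0`. -/
def singularValue (N : VonNeumannAlgebra H) (τ : (H →L[ℂ] H) → ℝ≥0∞) (A : H →L[ℂ] H) (t : ℝ) : ℝ :=
  sInf {r | ∃ p ∈ N, IsStarProjection p ∧ τ (1 - p) ≤ ENNReal.ofReal t ∧ r = ‖A * p‖}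

/-- The Dixmier ideal `M_{1,∞}(N, τ)`, that is, the Marcinkiewicz operator space for
`ψ(t) = log (1 + t)`. -/
def dixmierIdeal (N : VonNeumannAlgebra H) (τ : (H →L[ℂ] H) → ℝ≥0∞) : Set (H →L[ℂ] H) :=
  {A | A ∈ N ∧ ∃ C : ℝ, ∀ t : ℝ, 0 < t →
    1 / Real.log (1 + t) * ∫ s in (0 : ℝ)..t, singularValue N τ A s ≤ C}

/-- Hardy-Littlewood majorization `B ≺≺ A`. -/
def Majorized (N : VonNeumannAlgebra H) (τ : (H →L[ℂ] H) → ℝ≥0∞) (B A : H →L[ℂ] H) : Prop :=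
  ∀ t : ℝ, 0 ≤ t →
    ∫ s in (0 : ℝ)..t, singularValue N τ B s ≤ ∫ s in (0 : ℝ)..t, singularValue N τ A s

/-- The function `t ↦ (1/t) τ(A^{1+1/t})` on `(0,∞)`, for a positive operator `A`. -/
def zetaFun (τ : (H →L[ℂ] H) → ℝ≥0∞) (A : H →L[ℂ] H) (t : Ioi (0 : ℝ)) : ℝ :=
  1 / (t : ℝ) * (τ (A ^ (1 + 1 / (t : ℝ)))).toReal

open Classical in
/-- `ζ_γ(A) = γ((1/t) τ(A^{1+1/t}))` for a positive operator `A`. The function may be unbounded as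
`t → 0` (if `‖A‖ > 1`), but `γ` only sees the behaviour as `t → ∞`, so that it is applied to the
function cut off to `[1,∞)`. -/
def zetaPos (τ : (H →L[ℂ] H) → ℝ≥0∞) (γ : LInfty →ₗ[ℝ] ℝ) (A : H →L[ℂ] H) : ℝ :=
  if h : indicator {t : Ioi (0 : ℝ) | 1 ≤ (t : ℝ)} (zetaFun τ A) ∈ LInfty then γ ⟨_, h⟩ else 0

/-- The extension of `ζ_γ` to arbitrary operators through
`A = (ℜ(A)₊ - ℜ(A)₋) + i (ℑ(A)₊ - ℑ(A)₋)`. -/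
def zeta (τ : (H →L[ℂ] H) → ℝ≥0∞) (γ : LInfty →ₗ[ℝ] ℝ) (A : H →L[ℂ] H) : ℂ :=
  ((zetaPos τ γ (ℜ A : H →L[ℂ] H)⁺ : ℂ) - (zetaPos τ γ (ℜ A : H →L[ℂ] H)⁻ : ℂ)) +
    Complex.I *
      ((zetaPos τ γ (ℑ A : H →L[ℂ] H)⁺ : ℂ) - (zetaPos τ γ (ℑ A : H →L[ℂ] H)⁻ : ℂ))

/-- A linear functional on a space `S` of operators is fully symmetric if it is monotone on positive
operators for Hardy-Littlewood majorization. The inequality between complex numbers says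
that their difference is real and non-negative. -/
def IsFullySymmetric (N : VonNeumannAlgebra H) (τ : (H →L[ℂ] H) → ℝ≥0∞)
    {S : Submodule ℂ (H →L[ℂ] H)} (φ : S →ₗ[ℂ] ℂ) : Prop :=
  ∀ A B : S, 0 ≤ (A : H →L[ℂ] H) → 0 ≤ (B : H →L[ℂ] H) →
    Majorized N τ (B : H →L[ℂ] H) (A : H →L[ℂ] H) → φ B ≤ φ A

end ZetaFunctional

end

namespace ZetaFunctional

/-! With `s = 1/t`, the functional is a generalised limit of `s τ(A^{1+s})` as `s → 0+`. For
positive `A`, `B` and `0 < s < 1`, `τ(A^{1+s}) + τ(B^{1+s}) ≤ τ((A+B)^{1+s}) ≤ 2^s (τ(A^{1+s}) +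
τ(B^{1+s}))`. Since `2^s → 1` and `s τ(A^{1+s})` stays bounded on the ideal, the defect of
additivity tends to zero and the generalised limit does not see it. The left inequality
(`tau_rpow_add_tau_rpow_le`) comes from operator monotonicity of `x ↦ x^s` and the trace property;
the right one (`tau_add_rpow_le`) from operator convexity of `x ↦ x^{1+s}` at the midpoint.
Homogeneity is similar, because `c^{1+s} = c · c^s` and `c^s → 1`.

Boundedness and full symmetry both rest on `τ(A^p) = ∫ μ(t,A)^p dt` (`tau_rpow`) and on the fact
that majorization of a decreasing function `f` by `g` gives `∫ f^p ≤ ∫ g^p` for `p > 1`. For `B ≺≺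
A` this compares the two zeta functions at every `t`. For `A` in the ideal, `μ(·,A)` is majorized by
`u ↦ C/(1+u)`, whence `τ(A^{1+s}) ≤ C^{1+s}/s`.

The trace formula is obtained from continuous functional calculus alone. The spectral projection for
`(a,∞)` is the range projection of `(A-a)₊`; its trace, as a function of `a`, is the distribution
function of `μ(·,A)`, and normality turns layer sums into `τ(A) = ∫ τ(specProj A a) da`. The
comparison of projections needed for this is `tau_rangeProj_le`.

The extension to the whole ideal is linear because additivity on positive operators makes the value
on a self-adjoint operator independent of how it is written as a difference of positive ones. -/

/-- An operator is the least upper bound of a sequence of operators below it that converges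
to it strongly. -/
theorem isLUB_of_tendsto {H : Type*} [NormedAddCommGroup H] [InnerProductSpace ℂ H]
    {u : ℕ → H →L[ℂ] H} {A : H →L[ℂ] H} (hle : ∀ n, u n ≤ A)
    (hlim : ∀ v, Tendsto (fun n => u n v) atTop (𝓝 (A v))) : IsLUB (Set.range u) A := by
  refine ⟨by rintro _ ⟨n, rfl⟩; exact hle n, fun B hB => ?_⟩
  rw [ContinuousLinearMap.le_def]
  -- The upper bound `B` is not assumed self-adjoint; symmetry of `B - A` is inherited from the two
  -- positive differences with `u 0`.
  have hsym : (B - A).IsSymmetric := by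
    have h0 : (B - u 0).IsPositive := (ContinuousLinearMap.le_def _ _).1 (hB ⟨0, rfl⟩)
    have h1 : (A - u 0).IsPositive := (ContinuousLinearMap.le_def _ _).1 (hle 0)
    have : B - A = (B - u 0) - (A - u 0) := by abel
    rw [this]
    exact h0.isSymmetric.sub h1.isSymmetric
  refine ⟨hsym, fun v => ?_⟩
  have hn : ∀ n, 0 ≤ (B - u n).reApplyInnerSelf v := fun n =>
    ((ContinuousLinearMap.le_def _ _).1 (hB ⟨n, rfl⟩)).2 v
  have ht : Tendsto (fun n => (B - u n).reApplyInnerSelf v) atTop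
      (𝓝 ((B - A).reApplyInnerSelf v)) := by
    simp only [ContinuousLinearMap.reApplyInnerSelf_apply, sub_apply]
    exact (Complex.continuous_re.tendsto _).comp
      ((tendsto_const_nhds.sub (hlim v)).inner tendsto_const_nhds)
  exact ge_of_tendsto' ht hn

variable {H : Type*} [NormedAddCommGroup H] [InnerProductSpace ℂ H] [CompleteSpace H]
  {N : VonNeumannAlgebra H} {τ : (H →L[ℂ] H) → ℝ≥0∞}

/-! ### Membership in the von Neumann algebra, range projections, order properties of the trace -/

theorem cfc_mem {A : H →L[ℂ] H} (hA : A ∈ N) (f : ℝ → ℝ) : cfc f A ∈ N := by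
  rw [← N.commutant_commutant, VonNeumannAlgebra.mem_commutant_iff]
  intro y hy
  rw [VonNeumannAlgebra.mem_commutant_iff] at hy
  exact (Commute.cfc_real (show Commute A y from hy A hA) f).eq.symm

theorem rpow_mem {A : H →L[ℂ] H} (hA : A ∈ N) (p : ℝ) : A ^ p ∈ N := by
  rw [← N.commutant_commutant, VonNeumannAlgebra.mem_commutant_iff]
  intro y hy
  rw [VonNeumannAlgebra.mem_commutant_iff] at hy
  exact (Commute.cfc_nnreal (show Commute A y from hy A hA) _).eq.symm

theorem cfcₙ_mem {A : H →L[ℂ] H} (hA : A ∈ N) (f : ℝ → ℝ) : cfcₙ f A ∈ N := by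
  rw [← N.commutant_commutant, VonNeumannAlgebra.mem_commutant_iff]
  intro y hy
  rw [VonNeumannAlgebra.mem_commutant_iff] at hy
  exact (Commute.cfcₙ_real (show Commute A y from hy A hA) f).eq.symm

theorem real_smul_mem {A : H →L[ℂ] H} (hA : A ∈ N) (c : ℝ) : c • A ∈ N := by
  rw [← Complex.coe_smul]
  exact N.toStarSubalgebra.smul_mem hA _

theorem complex_smul_mem {A : H →L[ℂ] H} (hA : A ∈ N) (c : ℂ) : c • A ∈ N :=
  N.toStarSubalgebra.smul_mem hA _

/-- The orthogonal projection onto the closure of the range of an operator. -/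
noncomputable def rangeProj (X : H →L[ℂ] H) : H →L[ℂ] H :=
  X.range.topologicalClosure.starProjection

theorem isStarProjection_rangeProj (X : H →L[ℂ] H) : IsStarProjection (rangeProj X) :=
  isStarProjection_starProjection

theorem rangeProj_mul (X : H →L[ℂ] H) : rangeProj X * X = X := by
  ext v
  exact Submodule.starProjection_eq_self_iff.2
    (Submodule.le_topologicalClosure _ (LinearMap.mem_range_self _ v))

theorem rangeProj_apply_mem (X : H →L[ℂ] H) (v : H) :
    rangeProj X v ∈ closure (Set.range X) :=
  Submodule.starProjection_apply_mem X.range.topologicalClosure v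

theorem mul_rangeProj_eq_zero {X Y : H →L[ℂ] H} (h : Y * X = 0) : Y * rangeProj X = 0 := by
  ext v
  have hcl : IsClosed {w : H | Y w = 0} := isClosed_eq Y.continuous continuous_const
  have hsub : Set.range X ⊆ {w : H | Y w = 0} := by
    rintro _ ⟨u, rfl⟩
    exact congr($h u)
  exact hcl.closure_subset_iff.2 hsub (rangeProj_apply_mem X v)

/-- Operators in the commutant of `N` commute with `X`, hence leave the closure of its range
invariant; for a projection this invariance characterises membership in `N`. -/
theorem rangeProj_mem {X : H →L[ℂ] H} (hX : X ∈ N) : rangeProj X ∈ N := by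
  rw [VonNeumannAlgebra.IsStarProjection.mem_iff (isStarProjection_rangeProj X)]
  intro y hy v hv
  rw [VonNeumannAlgebra.mem_commutant_iff] at hy
  obtain ⟨u, rfl⟩ := hv
  have h := isStarProjection_rangeProj X
  have key : (1 - rangeProj X) * y * rangeProj X = 0 := by
    apply mul_rangeProj_eq_zero
    rw [mul_assoc, ← hy X hX, ← mul_assoc, sub_mul, one_mul, rangeProj_mul, sub_self, zero_mul]
  refine ⟨y (rangeProj X u), ?_⟩
  have := congr($key u)
  simp [sub_mul] at this
  exact (sub_eq_zero.1 this).symm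

theorem tau_zero (hτ : IsFaithfulNormalSemifiniteTrace N τ) : τ 0 = 0 := by
  simpa using hτ.map_smul 0 le_rfl 0 (zero_mem _) le_rfl

theorem tau_mono (hτ : IsFaithfulNormalSemifiniteTrace N τ) {A B : H →L[ℂ] H} (hA : A ∈ N)
    (hB : B ∈ N) (h0 : 0 ≤ A) (hAB : A ≤ B) : τ A ≤ τ B := by
  have := hτ.map_add A hA (B - A) (sub_mem hB hA) h0 (sub_nonneg.2 hAB)
  rw [add_sub_cancel] at this
  rw [this]
  exact le_self_add

theorem tau_le_of_isLUB (hτ : IsFaithfulNormalSemifiniteTrace N τ) {u : ℕ → H →L[ℂ] H}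
    (hu : Monotone u) (huN : ∀ n, u n ∈ N) (hu0 : ∀ n, 0 ≤ u n) {A : H →L[ℂ] H} (hA : A ∈ N)
    (hlub : IsLUB (Set.range u) A) {c : ℝ≥0∞} (hc : ∀ n, τ (u n) ≤ c) : τ A ≤ c := by
  refine (hτ.normal (Set.range u) ?_ ?_ (Set.range_nonempty u) ?_ A hA hlub).2 ?_
  · rintro _ ⟨n, rfl⟩; exact huN n
  · rintro _ ⟨n, rfl⟩; exact hu0 n
  · exact directedOn_range.2 hu.directed_le
  · rintro _ ⟨_, ⟨n, rfl⟩, rfl⟩; exact hc n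

end ZetaFunctional

/-! ### Trace of a range projection -/

namespace ZetaFunctional
variable {H : Type*} [NormedAddCommGroup H] [InnerProductSpace ℂ H] [CompleteSpace H]
  {N : VonNeumannAlgebra H} {τ : (H →L[ℂ] H) → ℝ≥0∞}

theorem le_smul_of_conj_eq {q T : H →L[ℂ] H} (hq : IsStarProjection q) {c : ℝ}
    (hT : T ≤ c • 1) (h : q * T * q = T) : T ≤ c • q := by
  have := star_left_conjugate_le_conjugate hT q
  rw [hq.isSelfAdjoint.star_eq, h] at this
  simpa [hq.isIdempotentElem.eq] using this

theorem cfc_le_smul_one {f : ℝ → ℝ} {A : H →L[ℂ] H} {c : ℝ} (hA : IsSelfAdjoint A)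
    (hf : Continuous f) (h : ∀ x ∈ spectrum ℝ A, f x ≤ c) : cfc f A ≤ c • 1 := by
  have := cfc_le_algebraMap f c A h hf.continuousOn hA
  rwa [Algebra.algebraMap_eq_smul_one] at this

/-- A continuous regularisation of the sign function on the positive half-axis. -/
noncomputable def regSign (ε x : ℝ) : ℝ := x * (max x 0 + ε)⁻¹

/-- The truncation `max x 0` keeps the denominator at least `ε` on the whole line, so continuity
needs no information on the spectrum. -/
theorem continuous_regInv {ε : ℝ} (hε : 0 < ε) : Continuous fun x : ℝ => (max x 0 + ε)⁻¹ := by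
  refine Continuous.inv₀ (by fun_prop) fun x => ?_
  have := le_max_right x 0
  positivity

theorem continuous_regSign {ε : ℝ} (hε : 0 < ε) : Continuous (regSign ε) :=
  continuous_id.mul (continuous_regInv hε)

theorem regSign_le_one {ε x : ℝ} (hε : 0 < ε) (hx : 0 ≤ x) : regSign ε x ≤ 1 := by
  rw [regSign, max_eq_left hx, ← div_eq_mul_inv, div_le_one (by positivity)]
  linarith

theorem regSign_nonneg {ε x : ℝ} (hε : 0 < ε) (hx : 0 ≤ x) : 0 ≤ regSign ε x := by
  rw [regSign, max_eq_left hx]; positivity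

theorem regSign_anti {ε δ x : ℝ} (hε : 0 < ε) (h : ε ≤ δ) (hx : 0 ≤ x) :
    regSign δ x ≤ regSign ε x := by
  rw [regSign, regSign, max_eq_left hx]; gcongr

/-- With `T = X X*` and `g(x) = -ε/(x+ε)`, the squared norm is `‖g(T) T g(T)‖`, and `ε² x/(x+ε)² ≤
ε` for `x ≥ 0`. -/
theorem norm_cfc_regSign_mul_sub_le {ε : ℝ} (hε : 0 < ε) (X : H →L[ℂ] H) :
    ‖cfc (regSign ε) (X * star X) * X - X‖ ≤ √ε := by
  set T := X * star X with hT
  have hT0 : 0 ≤ T := mul_star_self_nonneg X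
  have hTs : IsSelfAdjoint T := .of_nonneg hT0
  set g : ℝ → ℝ := fun x => regSign ε x - 1 with hg
  have hgc : Continuous g := (continuous_regSign hε).sub continuous_const
  have e1 : cfc (regSign ε) T * X - X = cfc g T * X := by
    rw [hg, cfc_sub _ _ T (continuous_regSign hε).continuousOn continuousOn_const,
      cfc_const_one ℝ T, sub_mul, one_mul]
  have e2 : (cfc g T * X) * star (cfc g T * X) = cfc (fun x => g x * x * g x) T := by
    rw [star_mul, (cfc_predicate g T : IsSelfAdjoint _).star_eq]
    rw [cfc_mul (fun x => g x * x) g T (by fun_prop) hgc.continuousOn,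
      cfc_mul g (fun x => x) T hgc.continuousOn (by fun_prop), cfc_id' ℝ T hTs, hT]
    simp only [mul_assoc]
  have e3 : ‖cfc (fun x => g x * x * g x) T‖ ≤ ε := by
    refine norm_cfc_le hε.le fun x hx => ?_
    have hx0 : 0 ≤ x := spectrum_nonneg_of_nonneg hT0 hx
    have : g x = - (ε / (x + ε)) := by
      simp only [hg, regSign, max_eq_left hx0]; field_simp; ring
    have hnn : 0 ≤ -(ε / (x + ε)) * x * -(ε / (x + ε)) := by
      nlinarith [mul_nonneg hx0 (sq_nonneg (ε / (x + ε)))]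
    rw [this, Real.norm_of_nonneg hnn]
    have h1 : -(ε / (x + ε)) * x * -(ε / (x + ε)) = ε * ((ε * x) / (x + ε) ^ 2) := by
      field_simp
    rw [h1]
    have : (ε * x) / (x + ε) ^ 2 ≤ 1 := by
      rw [div_le_one (by positivity)]; nlinarith
    nlinarith
  rw [e1]
  refine Real.le_sqrt_of_sq_le ?_
  rw [sq, ← CStarRing.norm_self_mul_star, e2]
  exact e3

/-- On the range of `X` the previous estimate gives convergence to the identity; the uniform bound
`1` extends it to the closure, and on the orthogonal complement every term vanishes. -/
theorem tendsto_cfc_regSign (X : H →L[ℂ] H) {ε : ℕ → ℝ} (hε : ∀ n, 0 < ε n)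
    (hlim : Tendsto ε atTop (𝓝 0)) (v : H) :
    Tendsto (fun n => cfc (regSign (ε n)) (X * star X) v) atTop (𝓝 (rangeProj X v)) := by
  set T := X * star X with hT
  have hT0 : 0 ≤ T := mul_star_self_nonneg X
  have hTs : IsSelfAdjoint T := .of_nonneg hT0
  have hnorm : ∀ n, ‖cfc (regSign (ε n)) T‖ ≤ 1 := fun n => by
    refine norm_cfc_le zero_le_one fun x hx => ?_
    have hx0 : 0 ≤ x := spectrum_nonneg_of_nonneg hT0 hx
    rw [Real.norm_of_nonneg (regSign_nonneg (hε n) hx0)]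
    exact regSign_le_one (hε n) hx0
  have hright : ∀ n, cfc (regSign (ε n)) T * rangeProj X = cfc (regSign (ε n)) T := fun n => by
    have : cfc (regSign (ε n)) T = cfc (fun x => (max x 0 + ε n)⁻¹) T * T := by
      have : regSign (ε n) = fun x => (max x 0 + ε n)⁻¹ * x := by
        ext x; rw [regSign, mul_comm]
      rw [this, cfc_mul _ _ T (continuous_regInv (hε n)).continuousOn (by fun_prop),
        cfc_id' ℝ T hTs]
    have h2 : T * rangeProj X = T := by
      have := congr(star $(rangeProj_mul X))
      rw [star_mul, (isStarProjection_rangeProj X).isSelfAdjoint.star_eq] at this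
      rw [hT, mul_assoc, this]
    rw [this, mul_assoc, h2]
  have hcl : ∀ w ∈ closure (Set.range X),
      Tendsto (fun n => cfc (regSign (ε n)) T w) atTop (𝓝 w) := by
    intro w hw
    rw [Metric.tendsto_atTop]
    intro δ hδ
    obtain ⟨_, ⟨u, rfl⟩, hu⟩ := Metric.mem_closure_iff.1 hw (δ / 3) (by positivity)
    have hs : Tendsto (fun n => √(ε n) * ‖u‖) atTop (𝓝 0) := by
      have := ((Real.continuous_sqrt.tendsto 0).comp hlim).mul_const ‖u‖
      simpa using this
    obtain ⟨n₀, hn₀⟩ := (hs.eventually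
      (gt_mem_nhds (show 0 < δ / 3 by positivity))).exists_forall_of_atTop
    refine ⟨n₀, fun n hn => ?_⟩
    have h1 : ‖cfc (regSign (ε n)) T (X u) - X u‖ < δ / 3 := by
      refine lt_of_le_of_lt ?_ (hn₀ n hn)
      exact ((cfc (regSign (ε n)) T * X - X).le_opNorm u).trans
        (mul_le_mul_of_nonneg_right (norm_cfc_regSign_mul_sub_le (hε n) X) (norm_nonneg u))
    have h2 : ‖cfc (regSign (ε n)) T (w - X u)‖ ≤ ‖w - X u‖ := by
      simpa using ((cfc (regSign (ε n)) T).le_opNorm (w - X u)).trans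
        (mul_le_mul_of_nonneg_right (hnorm n) (norm_nonneg _))
    rw [dist_eq_norm] at hu ⊢
    have h3 : cfc (regSign (ε n)) T w - w = cfc (regSign (ε n)) T (w - X u)
        + (cfc (regSign (ε n)) T (X u) - X u) - (w - X u) := by
      rw [map_sub]; abel
    rw [h3]
    have := norm_sub_le (cfc (regSign (ε n)) T (w - X u)
        + (cfc (regSign (ε n)) T (X u) - X u)) (w - X u)
    have := norm_add_le (cfc (regSign (ε n)) T (w - X u)) (cfc (regSign (ε n)) T (X u) - X u)
    linarith
  have := hcl _ (rangeProj_apply_mem X v)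
  refine this.congr fun n => ?_
  exact congr($(hright n) v)

/-- A substitute for Murray-von Neumann equivalence of left and right supports that avoids the polar
decomposition. For `T = X X*` and `Z = (T+ε)^{-1/2} X`, the operators `Z Z* = T/(T+ε)` increase to
the range projection as `ε → 0`, while `Z* Z ≤ q` because `‖Z‖ ≤ 1` and `Z q = Z`. The trace
property and normality conclude. -/
theorem tau_rangeProj_le (hτ : IsFaithfulNormalSemifiniteTrace N τ) {X q : H →L[ℂ] H}
    (hX : X ∈ N) (hqN : q ∈ N) (hq : IsStarProjection q) (h : X * q = X) :
    τ (rangeProj X) ≤ τ q := by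
  set T := X * star X with hT
  have hT0 : 0 ≤ T := mul_star_self_nonneg X
  have hTs : IsSelfAdjoint T := .of_nonneg hT0
  have hTN : T ∈ N := mul_mem hX (star_mem hX)
  set ε : ℕ → ℝ := fun n => 1 / ((n : ℝ) + 1)
  have hε : ∀ n, 0 < ε n := fun n => by positivity
  have hspec : ∀ x ∈ spectrum ℝ T, 0 ≤ x := fun x hx => spectrum_nonneg_of_nonneg hT0 hx
  have hnn : ∀ n, 0 ≤ cfc (regSign (ε n)) T := fun n =>
    cfc_nonneg fun x hx => regSign_nonneg (hε n) (hspec x hx)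
  have hle1 : ∀ n, cfc (regSign (ε n)) T ≤ (1 : ℝ) • 1 := fun n =>
    cfc_le_smul_one hTs (continuous_regSign (hε n)) fun x hx => regSign_le_one (hε n) (hspec x hx)
  have hdecomp : ∀ n, ∃ Z ∈ N, Z * star Z = cfc (regSign (ε n)) T ∧ Z * q = Z ∧
      rangeProj X * (Z * star Z) = Z * star Z := by
    intro n
    set g : ℝ → ℝ := fun x => √((max x 0 + ε n)⁻¹) with hg
    have hgc : Continuous g := Real.continuous_sqrt.comp (continuous_regInv (hε n))
    have hZ : (cfc g T * X) * star (cfc g T * X) = cfc (regSign (ε n)) T := by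
      rw [star_mul, (cfc_predicate g T : IsSelfAdjoint _).star_eq]
      have : regSign (ε n) = fun x => g x * x * g x := by
        ext x
        have : 0 ≤ (max x 0 + ε n)⁻¹ := by
          have := hε n
          have := le_max_right x 0
          positivity
        rw [regSign, hg]
        dsimp only
        rw [mul_right_comm, Real.mul_self_sqrt this, mul_comm]
      rw [this, cfc_mul (fun x => g x * x) g T (by fun_prop) hgc.continuousOn,
        cfc_mul g (fun x => x) T hgc.continuousOn (by fun_prop), cfc_id' ℝ T hTs, hT]
      simp only [mul_assoc]
    refine ⟨cfc g T * X, mul_mem (cfc_mem hTN g) hX, hZ, by rw [mul_assoc, h], ?_⟩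
    rw [hZ]
    have : cfc (regSign (ε n)) T = T * cfc (fun x => (max x 0 + ε n)⁻¹) T := by
      have : regSign (ε n) = fun x => x * (max x 0 + ε n)⁻¹ := rfl
      rw [this, cfc_mul _ _ T (by fun_prop) (continuous_regInv (hε n)).continuousOn,
        cfc_id' ℝ T hTs]
    rw [this, ← mul_assoc, hT, ← mul_assoc, rangeProj_mul]
  refine tau_le_of_isLUB hτ (u := fun n => cfc (regSign (ε n)) T) ?_
    (fun n => cfc_mem hTN _) hnn (rangeProj_mem hX) ?_ ?_
  · intro m n hmn
    refine cfc_mono (fun x hx => regSign_anti (hε n) ?_ (hspec x hx))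
      (continuous_regSign (hε m)).continuousOn (continuous_regSign (hε n)).continuousOn
    exact one_div_le_one_div_of_le (by positivity) (by gcongr)
  · refine isLUB_of_tendsto (fun n => ?_)
      (tendsto_cfc_regSign X hε tendsto_one_div_add_atTop_nhds_zero_nat)
    obtain ⟨Z, -, hZ, -, hr⟩ := hdecomp n
    have hr' := congr(star $hr)
    rw [star_mul, star_mul, star_star, (isStarProjection_rangeProj X).isSelfAdjoint.star_eq] at hr'
    rw [hZ] at hr hr'
    simpa using le_smul_of_conj_eq (isStarProjection_rangeProj X) (hle1 n) (by rw [hr, hr'])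
  · intro n
    obtain ⟨Z, hZN, hZ, hZq, -⟩ := hdecomp n
    rw [← hZ, ← hτ.tracial Z hZN]
    refine tau_mono hτ (mul_mem (star_mem hZN) hZN) hqN (star_mul_self_nonneg Z) ?_
    have hn : ‖Z‖ ^ 2 ≤ 1 := by
      rw [sq, ← CStarRing.norm_self_mul_star, hZ]
      have := (CStarAlgebra.norm_le_one_iff_of_nonneg _ (hnn n)).2 (by simpa using hle1 n)
      exact this
    have h1 : star Z * Z ≤ (1 : ℝ) • 1 := by
      have := CStarAlgebra.star_mul_le_algebraMap_norm_sq (a := Z)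
      refine this.trans ?_
      rw [Algebra.algebraMap_eq_smul_one]
      gcongr
    have h2 : q * (star Z * Z) * q = star Z * Z := by
      have := congr(star $hZq)
      rw [star_mul, hq.isSelfAdjoint.star_eq] at this
      rw [mul_assoc, mul_assoc, hZq, ← mul_assoc, this]
    simpa using le_smul_of_conj_eq hq h1 h2

end ZetaFunctional

/-! ### Spectral projections -/

namespace ZetaFunctional
variable {H : Type*} [NormedAddCommGroup H] [InnerProductSpace ℂ H] [CompleteSpace H]
  {N : VonNeumannAlgebra H} {τ : (H →L[ℂ] H) → ℝ≥0∞}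

/-- The spectral projection of a self-adjoint operator `A` for the half-line `(a, ∞)`. -/
noncomputable def specProj (A : H →L[ℂ] H) (a : ℝ) : H →L[ℂ] H :=
  rangeProj (cfc (fun x => max (x - a) 0) A)

theorem isStarProjection_specProj (A : H →L[ℂ] H) (a : ℝ) : IsStarProjection (specProj A a) :=
  isStarProjection_rangeProj _

theorem specProj_mem {A : H →L[ℂ] H} (hA : A ∈ N) (a : ℝ) : specProj A a ∈ N :=
  rangeProj_mem (cfc_mem hA _)

/-- A function of `A` that vanishes on `(-∞, a]` lives on the spectral projection for `(a, ∞)`. -/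
theorem cfc_mul_specProj_of_eq {A : H →L[ℂ] H} {a : ℝ} {f h : ℝ → ℝ}
    (hh : Continuous h) (hfh : ∀ x ∈ spectrum ℝ A, f x = h x * max (x - a) 0) :
    cfc f A * specProj A a = cfc f A ∧ specProj A a * cfc f A = cfc f A := by
  have h1 : specProj A a * cfc f A = cfc f A := by
    have : cfc f A = cfc (fun x => max (x - a) 0) A * cfc h A := by
      rw [← cfc_mul _ _ A (by fun_prop) hh.continuousOn]
      exact cfc_congr fun x hx => by rw [hfh x hx, mul_comm]
    rw [this, ← mul_assoc, specProj, rangeProj_mul]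
  refine ⟨?_, h1⟩
  have := congr(star $h1)
  rwa [star_mul, (cfc_predicate f A : IsSelfAdjoint _).star_eq,
    (isStarProjection_specProj A a).isSelfAdjoint.star_eq] at this

/-- A function of `A` that is constant on `(a, ∞)` acts as a scalar on the spectral projection. -/
theorem cfc_mul_specProj_of_const {A : H →L[ℂ] H} {a c : ℝ} {f : ℝ → ℝ}
    (hf : Continuous f) (hfc : ∀ x ∈ spectrum ℝ A, a ≤ x → f x = c) :
    cfc f A * specProj A a = c • specProj A a ∧ specProj A a * cfc f A = c • specProj A a := by
  have h1 : cfc f A * specProj A a = c • specProj A a := by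
    have h0 : (cfc f A - c • 1) * cfc (fun x => max (x - a) 0) A = 0 := by
      rw [sub_mul, ← cfc_mul _ _ A hf.continuousOn (by fun_prop), smul_mul_assoc, one_mul,
        ← cfc_smul c _ A (by fun_prop), sub_eq_zero]
      refine cfc_congr fun x hx => ?_
      rcases le_total a x with h | h
      · simp [hfc x hx h]
      · simp [max_eq_right (sub_nonpos.2 h)]
    have := mul_rangeProj_eq_zero h0
    rw [sub_mul, smul_mul_assoc, one_mul, sub_eq_zero] at this
    exact this
  refine ⟨h1, ?_⟩
  have := congr(star $h1)
  rw [star_mul, (cfc_predicate f A : IsSelfAdjoint _).star_eq, star_smul,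
    (isStarProjection_specProj A a).isSelfAdjoint.star_eq] at this
  simpa using this

/-- If `f` is bounded by `c` on `[0, b]` then `f(A)` is bounded by `c` off the spectral projection
for `(a, ∞)`, where `a < b`. -/
theorem norm_cfc_mul_one_sub_specProj_le {A : H →L[ℂ] H} {a b c : ℝ}
    (hab : a < b) {f : ℝ → ℝ} (hf : Continuous f) (hc : 0 ≤ c)
    (h0 : ∀ x ∈ spectrum ℝ A, 0 ≤ f x) (hle : ∀ x ∈ spectrum ℝ A, x ≤ b → f x ≤ c) :
    ‖cfc f A * (1 - specProj A a)‖ ≤ c := by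
  have h1 : cfc (fun x => max (f x - c) 0) A * specProj A a = cfc (fun x => max (f x - c) 0) A := by
    -- The quotient by `x - a` is only needed for `x ≥ b`, so truncating the denominator at `b - a >
    -- 0` makes it continuous; this is where the gap `a < b` is used.
    refine (cfc_mul_specProj_of_eq (h := fun x => max (f x - c) 0 * (max (x - a) (b - a))⁻¹)
      ?_ ?_).1
    · refine Continuous.mul (by fun_prop) (Continuous.inv₀ (by fun_prop) fun x => ?_)
      exact ((sub_pos.2 hab).trans_le (le_max_right _ _)).ne'
    · intro x hx
      rcases le_total x b with h | h
      · simp [max_eq_right (sub_nonpos.2 (hle x hx h))]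
      · have : 0 < x - a := by linarith
        rw [max_eq_left (show b - a ≤ x - a by linarith), max_eq_left this.le, mul_assoc,
          inv_mul_cancel₀ this.ne', mul_one]
  have h2 : cfc f A = cfc (fun x => min (f x) c) A + cfc (fun x => max (f x - c) 0) A := by
    rw [← cfc_add A _ _ (by fun_prop) (by fun_prop)]
    refine cfc_congr fun x hx => ?_
    rcases le_total (f x) c with h | h
    · simp [min_eq_left h, max_eq_right (sub_nonpos.2 h)]
    · simp [min_eq_right h, max_eq_left (sub_nonneg.2 h)]
  have h3 : cfc f A * (1 - specProj A a) =
      cfc (fun x => min (f x) c) A * (1 - specProj A a) := by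
    rw [h2, add_mul, mul_sub, mul_sub, mul_one, mul_one, h1, sub_self, add_zero]
  rw [h3]
  have h4 : ‖cfc (fun x => min (f x) c) A‖ ≤ c := by
    refine norm_cfc_le hc fun x hx => ?_
    rw [Real.norm_of_nonneg (le_min (h0 x hx) hc)]
    exact min_le_right _ _
  have h5 : ‖1 - specProj A a‖ ≤ 1 := (isStarProjection_specProj A a).one_sub.norm_le
  exact (norm_mul_le _ _).trans (by nlinarith [norm_nonneg (1 - specProj A a)])

/-- If `r` is the range projection of `e(1-p)`, then `Y = (1-r)e` satisfies `Y = Y(ep)`; as `‖ep‖ <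
1`, `Y = 0`. So `e ≤ r`, and the trace of `r` is at most that of `1 - p`. -/
theorem tau_le_of_norm_mul_lt_one (hτ : IsFaithfulNormalSemifiniteTrace N τ) {e p : H →L[ℂ] H}
    (heN : e ∈ N) (he : IsStarProjection e) (hpN : p ∈ N) (hp : IsStarProjection p)
    (h : ‖e * p‖ < 1) : τ e ≤ τ (1 - p) := by
  set X := e * (1 - p) with hX
  have hXN : X ∈ N := mul_mem heN (sub_mem (one_mem N) hpN)
  refine le_trans ?_ (tau_rangeProj_le hτ hXN (sub_mem (one_mem N) hpN) hp.one_sub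
    (by rw [hX, mul_assoc, hp.one_sub.isIdempotentElem.eq]))
  refine tau_mono hτ heN (rangeProj_mem hXN) he.nonneg ?_
  rw [he.le_iff_mul_eq_right (isStarProjection_rangeProj X)]
  set Y := (1 - rangeProj X) * e with hY
  have h1 : Y = Y * (e * p) := by
    have : (1 - rangeProj X) * X = 0 := by rw [sub_mul, one_mul, rangeProj_mul, sub_self]
    rw [hX, ← mul_assoc, mul_sub, mul_one, sub_eq_zero] at this
    rw [hY, ← mul_assoc, mul_assoc _ e e, he.isIdempotentElem.eq]
    exact this
  have h2 : ‖Y‖ = 0 := by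
    have : ‖Y‖ ≤ ‖Y‖ * ‖e * p‖ := by
      conv_lhs => rw [h1]
      exact norm_mul_le _ _
    nlinarith [norm_nonneg Y]
  have h3 := norm_eq_zero.1 h2
  rw [hY, sub_mul, one_mul, sub_eq_zero] at h3
  exact h3.symm

/-- On its spectral subspace for `(a,∞)`, `A` is invertible with inverse of norm at most `1/a`, so
`‖A p‖ < a` forces `‖specProj A a * p‖ < 1`. -/
theorem tau_specProj_le (hτ : IsFaithfulNormalSemifiniteTrace N τ) {A p : H →L[ℂ] H} (hA : A ∈ N)
    (hA0 : 0 ≤ A) {a : ℝ} (hpN : p ∈ N) (hp : IsStarProjection p) (h : ‖A * p‖ < a) :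
    τ (specProj A a) ≤ τ (1 - p) := by
  have ha : 0 < a := (norm_nonneg _).trans_lt h
  have hAs : IsSelfAdjoint A := .of_nonneg hA0
  refine tau_le_of_norm_mul_lt_one hτ (specProj_mem hA a) (isStarProjection_specProj A a) hpN hp ?_
  set k : ℝ → ℝ := fun x => (max x a)⁻¹ with hk
  have hkc : Continuous k := Continuous.inv₀ (by fun_prop) fun x =>
    (ha.trans_le (le_max_right x a)).ne'
  have h1 : specProj A a * cfc (fun x => k x * x) A = (1 : ℝ) • specProj A a := by
    refine (cfc_mul_specProj_of_const (by fun_prop) fun x _ hx => ?_).2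
    rw [hk]
    dsimp only
    rw [max_eq_left hx, inv_mul_cancel₀ (ha.trans_le hx).ne']
  rw [cfc_mul _ _ A hkc.continuousOn (by fun_prop), cfc_id' ℝ A hAs, one_smul] at h1
  have h2 : ‖cfc k A‖ ≤ a⁻¹ := by
    refine norm_cfc_le (by positivity) fun x hx => ?_
    have := le_max_right x a
    rw [Real.norm_of_nonneg (inv_nonneg.2 (ha.le.trans this))]
    exact inv_anti₀ ha this
  calc ‖specProj A a * p‖ = ‖specProj A a * (cfc k A * (A * p))‖ := by
        conv_lhs => rw [← h1]
        simp only [mul_assoc]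
    _ ≤ ‖specProj A a‖ * (‖cfc k A‖ * ‖A * p‖) :=
        (norm_mul_le _ _).trans (mul_le_mul_of_nonneg_left (norm_mul_le _ _) (norm_nonneg _))
    _ ≤ 1 * (a⁻¹ * ‖A * p‖) := by
        gcongr
        exact (isStarProjection_specProj A a).norm_le
    _ < 1 := by rw [one_mul, inv_mul_lt_one₀ ha]; exact h

/-! ### Singular values -/

theorem bddBelow_singularValue (A : H →L[ℂ] H) (t : ℝ) :
    BddBelow {r | ∃ p ∈ N, IsStarProjection p ∧ τ (1 - p) ≤ ENNReal.ofReal t ∧ r = ‖A * p‖} :=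
  ⟨0, by rintro _ ⟨p, -, -, -, rfl⟩; exact norm_nonneg _⟩

theorem nonempty_singularValue (hτ : IsFaithfulNormalSemifiniteTrace N τ) (A : H →L[ℂ] H) (t : ℝ) :
    {r | ∃ p ∈ N, IsStarProjection p ∧ τ (1 - p) ≤ ENNReal.ofReal t ∧ r = ‖A * p‖}.Nonempty :=
  ⟨_, 1, one_mem N, .one _, by simp [tau_zero hτ], rfl⟩

theorem singularValue_nonneg (A : H →L[ℂ] H) (t : ℝ) : 0 ≤ singularValue N τ A t :=
  Real.sInf_nonneg (by rintro _ ⟨p, -, -, -, rfl⟩; exact norm_nonneg _)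

theorem singularValue_le {A p : H →L[ℂ] H} {t c : ℝ} (hpN : p ∈ N) (hp : IsStarProjection p)
    (ht : τ (1 - p) ≤ ENNReal.ofReal t) (hc : ‖A * p‖ ≤ c) : singularValue N τ A t ≤ c :=
  (csInf_le (bddBelow_singularValue A t) ⟨p, hpN, hp, ht, rfl⟩).trans hc

theorem exists_of_singularValue_lt (hτ : IsFaithfulNormalSemifiniteTrace N τ) {A : H →L[ℂ] H}
    {t c : ℝ} (h : singularValue N τ A t < c) :
    ∃ p ∈ N, IsStarProjection p ∧ τ (1 - p) ≤ ENNReal.ofReal t ∧ ‖A * p‖ < c := by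
  obtain ⟨_, ⟨p, hpN, hp, ht, rfl⟩, hlt⟩ :=
    exists_lt_of_csInf_lt (nonempty_singularValue hτ A t) h
  exact ⟨p, hpN, hp, ht, hlt⟩

theorem singularValue_antitone (hτ : IsFaithfulNormalSemifiniteTrace N τ) (A : H →L[ℂ] H) :
    Antitone (singularValue N τ A) := by
  intro s t hst
  refine le_of_forall_gt fun c hc => ?_
  obtain ⟨p, hpN, hp, ht, hlt⟩ := exists_of_singularValue_lt hτ hc
  exact (singularValue_le hpN hp (ht.trans (ENNReal.ofReal_le_ofReal hst)) le_rfl).trans_lt hlt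

theorem singularValue_le_norm (hτ : IsFaithfulNormalSemifiniteTrace N τ) (A : H →L[ℂ] H) (t : ℝ) :
    singularValue N τ A t ≤ ‖A‖ :=
  singularValue_le (one_mem N) (.one _) (by simp [tau_zero hτ]) (by simp)

/-- Comparison of singular values through a map of projections. -/
theorem singularValue_le_of_forall (hτ : IsFaithfulNormalSemifiniteTrace N τ) {A B : H →L[ℂ] H}
    {t : ℝ} (h : ∀ p ∈ N, IsStarProjection p → ∃ q ∈ N, IsStarProjection q ∧
      τ (1 - q) ≤ τ (1 - p) ∧ ‖B * q‖ ≤ ‖A * p‖) :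
    singularValue N τ B t ≤ singularValue N τ A t := by
  refine le_of_forall_gt fun c hc => ?_
  obtain ⟨p, hpN, hp, ht, hlt⟩ := exists_of_singularValue_lt hτ hc
  obtain ⟨q, hqN, hq, hqt, hqle⟩ := h p hpN hp
  exact (singularValue_le hqN hq (hqt.trans ht) hqle).trans_lt hlt

theorem norm_mul_le_of_star_mul_le {A B : H →L[ℂ] H} (h : star B * B ≤ star A * A)
    (p : H →L[ℂ] H) : ‖B * p‖ ≤ ‖A * p‖ := by
  have h1 := star_left_conjugate_le_conjugate h p
  have e : ∀ C : H →L[ℂ] H, star p * (star C * C) * p = star (C * p) * (C * p) := fun C => by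
    rw [star_mul]; simp only [mul_assoc]
  rw [e, e] at h1
  have h2 := CStarAlgebra.norm_le_norm_of_nonneg_of_le (star_mul_self_nonneg _) h1
  rw [CStarRing.norm_star_mul_self, CStarRing.norm_star_mul_self] at h2
  nlinarith [norm_nonneg (A * p), norm_nonneg (B * p)]

theorem singularValue_le_of_star_mul_le (hτ : IsFaithfulNormalSemifiniteTrace N τ)
    {A B : H →L[ℂ] H} (h : star B * B ≤ star A * A) (t : ℝ) :
    singularValue N τ B t ≤ singularValue N τ A t :=
  singularValue_le_of_forall hτ fun p hpN hp =>
    ⟨p, hpN, hp, le_rfl, norm_mul_le_of_star_mul_le h p⟩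

/-- For a competitor `p` for `A`, let `q` be the complement of the range projection of `A(1-p)`.
Then `q A = q A p`, so `‖A* q‖ ≤ ‖A p‖`, and `1 - q` has trace at most that of `1 - p`. -/
theorem singularValue_star_le (hτ : IsFaithfulNormalSemifiniteTrace N τ) {A : H →L[ℂ] H}
    (hA : A ∈ N) (t : ℝ) : singularValue N τ (star A) t ≤ singularValue N τ A t := by
  refine singularValue_le_of_forall hτ fun p hpN hp => ?_
  set X := A * (1 - p) with hX
  have h1p : 1 - p ∈ N := sub_mem (one_mem N) hpN
  have hXN : X ∈ N := mul_mem hA h1p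
  have hr := isStarProjection_rangeProj X
  refine ⟨1 - rangeProj X, sub_mem (one_mem N) (rangeProj_mem hXN), hr.one_sub, ?_, ?_⟩
  · rw [sub_sub_cancel]
    exact tau_rangeProj_le hτ hXN h1p hp.one_sub (by
      rw [hX, mul_assoc, hp.one_sub.isIdempotentElem.eq])
  · have h0 : (1 - rangeProj X) * (A * (1 - p)) = 0 := by
      rw [← hX, sub_mul, one_mul, rangeProj_mul, sub_self]
    have h1 : (1 - rangeProj X) * A = (1 - rangeProj X) * (A * p) := by
      rw [mul_sub, mul_one, mul_sub, sub_eq_zero] at h0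
      exact h0
    have h2 : star A * (1 - rangeProj X) = star ((1 - rangeProj X) * A) := by
      rw [star_mul, hr.one_sub.isSelfAdjoint.star_eq]
    rw [h2, norm_star, h1]
    exact (norm_mul_le _ _).trans (by nlinarith [hr.one_sub.norm_le, norm_nonneg (A * p)])

/-- Two projections have an upper bound whose trace is at most the sum of the traces. -/
theorem exists_projection_tau_le_add (hτ : IsFaithfulNormalSemifiniteTrace N τ)
    {e f : H →L[ℂ] H} (heN : e ∈ N) (he : IsStarProjection e) (hfN : f ∈ N)
    (hf : IsStarProjection f) :
    ∃ g ∈ N, IsStarProjection g ∧ g * e = e ∧ g * f = f ∧ τ g ≤ τ e + τ f := by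
  set X := (1 - e) * f with hX
  have hXN : X ∈ N := mul_mem (sub_mem (one_mem N) heN) hfN
  have hr := isStarProjection_rangeProj X
  have her : e * rangeProj X = 0 := mul_rangeProj_eq_zero (by
    rw [hX, ← mul_assoc, he.mul_one_sub_self, zero_mul])
  have hre : rangeProj X * e = 0 := by
    have := congr(star $her)
    rwa [star_mul, hr.isSelfAdjoint.star_eq, he.isSelfAdjoint.star_eq, star_zero] at this
  refine ⟨e + rangeProj X, add_mem heN (rangeProj_mem hXN), he.add hr her, ?_, ?_, ?_⟩
  · rw [add_mul, he.isIdempotentElem.eq, hre, add_zero]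
  · have h1 : rangeProj X * f = X := by
      have := rangeProj_mul X
      rw [hX, ← mul_assoc, mul_sub, mul_one, ← hX, hre, sub_zero] at this
      exact this
    rw [add_mul, h1, hX, sub_mul, one_mul, add_sub_cancel]
  · rw [hτ.map_add e heN _ (rangeProj_mem hXN) he.nonneg hr.nonneg]
    gcongr
    exact tau_rangeProj_le hτ hXN hfN hf (by rw [hX, mul_assoc, hf.isIdempotentElem.eq])

theorem singularValue_add_le (hτ : IsFaithfulNormalSemifiniteTrace N τ) (A B : H →L[ℂ] H)
    {s t : ℝ} (hs : 0 ≤ s) (ht : 0 ≤ t) :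
    singularValue N τ (A + B) (s + t) ≤ singularValue N τ A s + singularValue N τ B t := by
  refine le_of_forall_gt fun c hc => ?_
  obtain ⟨a, ha, b, hb, rfl⟩ : ∃ a, singularValue N τ A s < a ∧ ∃ b, singularValue N τ B t < b ∧
      a + b = c := by
    set d := c - (singularValue N τ A s + singularValue N τ B t)
    exact ⟨singularValue N τ A s + d / 2, by linarith, singularValue N τ B t + d / 2,
      by linarith, by simp only [d]; ring⟩
  obtain ⟨p, hpN, hp, hps, hpa⟩ := exists_of_singularValue_lt hτ ha
  obtain ⟨q, hqN, hq, hqt, hqb⟩ := exists_of_singularValue_lt hτ hb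
  obtain ⟨g, hgN, hg, hgp, hgq, hgτ⟩ := exists_projection_tau_le_add hτ
    (sub_mem (one_mem N) hpN) hp.one_sub (sub_mem (one_mem N) hqN) hq.one_sub
  have key : ∀ r : H →L[ℂ] H, IsStarProjection r → g * (1 - r) = 1 - r → r * (1 - g) = 1 - g := by
    intro r hr h
    have h := congr(star $h)
    rw [star_mul, hg.isSelfAdjoint.star_eq, hr.one_sub.isSelfAdjoint.star_eq] at h
    have : r * (1 - g) = 1 - g - ((1 - r) - (1 - r) * g) := by noncomm_ring
    rw [this, h, sub_self, sub_zero]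
  have hle : ∀ (C r : H →L[ℂ] H), r * (1 - g) = 1 - g → ‖C * (1 - g)‖ ≤ ‖C * r‖ := by
    intro C r h
    rw [← h, ← mul_assoc]
    exact (norm_mul_le _ _).trans (by nlinarith [hg.one_sub.norm_le, norm_nonneg (C * r)])
  refine (singularValue_le (p := 1 - g) (sub_mem (one_mem N) hgN) hg.one_sub ?_ le_rfl).trans_lt ?_
  · rw [sub_sub_cancel, ENNReal.ofReal_add hs ht]
    exact hgτ.trans (add_le_add hps hqt)
  · rw [add_mul]
    refine (norm_add_le _ _).trans_lt (add_lt_add ?_ ?_)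
    · exact (hle A p (key p hp hgp)).trans_lt hpa
    · exact (hle B q (key q hq hgq)).trans_lt hqb

theorem singularValue_smul_le (hτ : IsFaithfulNormalSemifiniteTrace N τ) (c : ℂ) (A : H →L[ℂ] H)
    (t : ℝ) : singularValue N τ (c • A) t ≤ ‖c‖ * singularValue N τ A t := by
  rcases eq_or_ne c 0 with rfl | hc
  · simpa using singularValue_le_norm hτ (0 : H →L[ℂ] H) t
  have hc' : 0 < ‖c‖ := norm_pos_iff.2 hc
  rw [← div_le_iff₀' hc']
  refine le_of_forall_gt fun b hb => ?_
  obtain ⟨p, hpN, hp, ht, hlt⟩ := exists_of_singularValue_lt hτ hb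
  refine (div_le_iff₀' hc').2 ?_ |>.trans_lt hlt
  exact singularValue_le hpN hp ht (by rw [smul_mul_assoc, norm_smul])

/-- Together with the next lemma this says that `t ↦ μ(t,A)` and `a ↦ τ(specProj A a)` are
generalised inverses of each other. -/
theorem singularValue_le_of_tau_specProj_le {A : H →L[ℂ] H} (hA : A ∈ N) (hA0 : 0 ≤ A)
    {a t : ℝ} (ha : 0 ≤ a) (h : τ (specProj A a) ≤ ENNReal.ofReal t) : singularValue N τ A t ≤ a := by
  refine le_of_forall_gt_imp_ge_of_dense fun b hb => ?_
  refine singularValue_le (p := 1 - specProj A a) (sub_mem (one_mem N) (specProj_mem hA a))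
    (isStarProjection_specProj A a).one_sub (by rwa [sub_sub_cancel]) ?_
  have := norm_cfc_mul_one_sub_specProj_le (A := A) hb (f := fun x => x) continuous_id
    (ha.trans hb.le) (fun x hx => spectrum_nonneg_of_nonneg hA0 hx) (fun x _ h => h)
  rwa [cfc_id' ℝ A] at this

theorem tau_specProj_le_of_singularValue_lt (hτ : IsFaithfulNormalSemifiniteTrace N τ)
    {A : H →L[ℂ] H} (hA : A ∈ N) (hA0 : 0 ≤ A) {a t : ℝ} (h : singularValue N τ A t < a) :
    τ (specProj A a) ≤ ENNReal.ofReal t := by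
  obtain ⟨p, hpN, hp, ht, hlt⟩ := exists_of_singularValue_lt hτ h
  exact (tau_specProj_le hτ hA hA0 hpN hp hlt).trans ht

theorem singularValue_rpow_le (hτ : IsFaithfulNormalSemifiniteTrace N τ) {A : H →L[ℂ] H}
    (hA : A ∈ N) (hA0 : 0 ≤ A) {p : ℝ} (hp : 0 < p) (t : ℝ) :
    singularValue N τ (A ^ p) t ≤ singularValue N τ A t ^ p := by
  have h0 := singularValue_nonneg (N := N) (τ := τ) A t
  have h0' := singularValue_nonneg (N := N) (τ := τ) (A ^ p) t
  rw [← Real.rpow_inv_le_iff_of_pos h0' h0 hp]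
  refine le_of_forall_gt_imp_ge_of_dense fun b hb => ?_
  -- The spectral projection is taken strictly below the bound `b`, since off it `x ^ p` is
  -- controlled only with such a gap.
  obtain ⟨a, ha, hab⟩ := exists_between hb
  have hb0 : 0 ≤ b := h0.trans hb.le
  rw [Real.rpow_inv_le_iff_of_pos h0' hb0 hp]
  refine singularValue_le (p := 1 - specProj A a) (sub_mem (one_mem N) (specProj_mem hA a))
    (isStarProjection_specProj A a).one_sub
    (by rw [sub_sub_cancel]; exact tau_specProj_le_of_singularValue_lt hτ hA hA0 ha) ?_
  rw [CFC.rpow_eq_cfc_real hA0]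
  refine norm_cfc_mul_one_sub_specProj_le hab (Real.continuous_rpow_const hp.le)
    (Real.rpow_nonneg hb0 p) (fun x hx => Real.rpow_nonneg (spectrum_nonneg_of_nonneg hA0 hx) p)
    fun x hx hxb => Real.rpow_le_rpow (spectrum_nonneg_of_nonneg hA0 hx) hxb hp.le

/-- The reverse inequality is the previous one applied to `A ^ p` and the exponent `p⁻¹`. -/
theorem singularValue_rpow (hτ : IsFaithfulNormalSemifiniteTrace N τ) {A : H →L[ℂ] H}
    (hA : A ∈ N) (hA0 : 0 ≤ A) {p : ℝ} (hp : 0 < p) (t : ℝ) :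
    singularValue N τ (A ^ p) t = singularValue N τ A t ^ p := by
  refine le_antisymm (singularValue_rpow_le hτ hA hA0 hp t) ?_
  have h0 := singularValue_nonneg (N := N) (τ := τ) A t
  have h0' := singularValue_nonneg (N := N) (τ := τ) (A ^ p) t
  have := singularValue_rpow_le hτ (rpow_mem hA p) CFC.rpow_nonneg (inv_pos.2 hp) t
  rw [CFC.rpow_rpow_of_exponent_nonneg A p p⁻¹ hp.le (inv_nonneg.2 hp.le) hA0,
    mul_inv_cancel₀ hp.ne', CFC.rpow_one A hA0] at this
  rwa [Real.le_rpow_inv_iff_of_pos h0 h0' hp] at this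

end ZetaFunctional

namespace ZetaFunctional
variable {H : Type*} [NormedAddCommGroup H] [InnerProductSpace ℂ H] [CompleteSpace H]
  {N : VonNeumannAlgebra H} {τ : (H →L[ℂ] H) → ℝ≥0∞}

/-! ### The trace as an integral of singular values -/

theorem specProj_antitone (A : H →L[ℂ] H) : Antitone (specProj A) := by
  intro a b hab
  rcases hab.eq_or_lt with rfl | hab
  · rfl
  have h1 : specProj A a * cfc (fun x => max (x - b) 0) A = cfc (fun x => max (x - b) 0) A := by
    refine (cfc_mul_specProj_of_eq (h := fun x => max (x - b) 0 * (max (x - a) (b - a))⁻¹) ?_ ?_).2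
    · refine Continuous.mul (by fun_prop) (Continuous.inv₀ (by fun_prop) fun x => ?_)
      exact ((sub_pos.2 hab).trans_le (le_max_right _ _)).ne'
    · intro x _
      rcases le_total x b with h | h
      · simp [max_eq_right (sub_nonpos.2 h)]
      · have : 0 < x - a := by linarith
        rw [max_eq_left (show b - a ≤ x - a by linarith), max_eq_left this.le, mul_assoc,
          inv_mul_cancel₀ this.ne', mul_one]
  have h2 : (1 - specProj A a) * specProj A b = 0 := mul_rangeProj_eq_zero (by
    rw [sub_mul, one_mul, h1, sub_self])
  rw [sub_mul, one_mul, sub_eq_zero] at h2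
  exact ((isStarProjection_specProj A b).le_iff_mul_eq_right (isStarProjection_specProj A a)).2
    h2.symm

theorem tau_specProj_antitone (hτ : IsFaithfulNormalSemifiniteTrace N τ) {A : H →L[ℂ] H}
    (hA : A ∈ N) : Antitone fun a => τ (specProj A a) := fun a b hab =>
  tau_mono hτ (specProj_mem hA b) (specProj_mem hA a) (isStarProjection_specProj A b).nonneg
    (specProj_antitone A hab)

/-- The operator `(A - a)₊`. -/
noncomputable def excess (A : H →L[ℂ] H) (a : ℝ) : H →L[ℂ] H := cfc (fun x => max (x - a) 0) A

theorem excess_mem {A : H →L[ℂ] H} (hA : A ∈ N) (a : ℝ) : excess A a ∈ N := cfc_mem hA _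

theorem excess_nonneg (A : H →L[ℂ] H) (a : ℝ) : 0 ≤ excess A a :=
  cfc_nonneg fun _ _ => le_max_right _ _

theorem excess_eq_zero {A : H →L[ℂ] H} {a : ℝ} (h : ‖A‖ ≤ a) : excess A a = 0 := by
  rcases subsingleton_or_nontrivial (H →L[ℂ] H) with _ | _
  · exact Subsingleton.elim _ _
  have : excess A a = cfc (fun _ => (0 : ℝ)) A := cfc_congr fun x hx =>
    max_eq_right (sub_nonpos.2 (((le_abs_self x).trans (spectrum.norm_le_norm_of_mem hx)).trans h))
  rw [this, cfc_const_zero]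

/-- The function `(x-a)₊ - (x-a-δ)₊ = min((x-a)₊, δ)` lies between `δ` times the indicators of
`(a+δ,∞)` and `(a,∞)`. These are one-step Riemann bounds for the trace, stated additively because
the traces may be infinite. -/
theorem tau_excess_add (hτ : IsFaithfulNormalSemifiniteTrace N τ) {A : H →L[ℂ] H} (hA : A ∈ N)
    (a : ℝ) {δ : ℝ} (hδ : 0 < δ) :
    τ (excess A a) ≤ ENNReal.ofReal δ * τ (specProj A a) + τ (excess A (a + δ)) ∧
    ENNReal.ofReal δ * τ (specProj A (a + δ)) + τ (excess A (a + δ)) ≤ τ (excess A a) := by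
  set ψ : ℝ → ℝ := fun x => min (max (x - a) 0) δ with hψ
  have hψc : Continuous ψ := by fun_prop
  have hψ0 : 0 ≤ cfc ψ A := cfc_nonneg fun x _ => le_min (le_max_right _ _) hδ.le
  have hsplit : excess A a = cfc ψ A + excess A (a + δ) := by
    rw [excess, excess, ← cfc_add A _ _ (by fun_prop) (by fun_prop)]
    refine cfc_congr fun x _ => ?_
    simp only [hψ]
    rcases le_total x (a + δ) with h | h
    · rw [max_eq_right (show x - (a + δ) ≤ 0 by linarith), add_zero, min_eq_left]
      exact max_le (by linarith) hδ.le
    · rw [max_eq_left (show 0 ≤ x - (a + δ) by linarith), max_eq_left (show 0 ≤ x - a by linarith),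
        min_eq_right (by linarith)]
      ring
  have hτs : τ (excess A a) = τ (cfc ψ A) + τ (excess A (a + δ)) := by
    rw [hsplit, hτ.map_add _ (cfc_mem hA _) _ (excess_mem hA _) hψ0 (excess_nonneg A _)]
  rw [hτs]
  constructor
  · gcongr
    rw [← hτ.map_smul δ hδ.le _ (specProj_mem hA a) (isStarProjection_specProj A a).nonneg]
    refine tau_mono hτ (cfc_mem hA _) (real_smul_mem (specProj_mem hA a) δ) hψ0 ?_
    have h1 := cfc_mul_specProj_of_eq (A := A) (a := a) (f := ψ)
      (h := fun x => δ * (max (x - a) δ)⁻¹)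
      (Continuous.mul continuous_const (Continuous.inv₀ (by fun_prop) fun x =>
        (hδ.trans_le (le_max_right _ _)).ne')) (by
      intro x _
      simp only [hψ]
      rcases le_total (x - a) δ with h | h
      · rw [max_eq_right h, mul_inv_cancel₀ hδ.ne', one_mul, min_eq_left (max_le h hδ.le)]
      · have h' : 0 < x - a := hδ.trans_le h
        rw [max_eq_left h, max_eq_left h'.le, min_eq_right h, mul_assoc, inv_mul_cancel₀ h'.ne',
          mul_one])
    refine le_smul_of_conj_eq (isStarProjection_specProj A a) ?_ (by rw [h1.2, h1.1])
    by_cases hAs : IsSelfAdjoint A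
    · exact cfc_le_smul_one hAs hψc fun x _ => min_le_right _ _
    · rw [cfc_apply_of_not_predicate A hAs]
      exact smul_nonneg hδ.le zero_le_one
  · gcongr
    set e := specProj A (a + δ) with he
    have hep : IsStarProjection e := isStarProjection_specProj A _
    rw [← hτ.map_smul δ hδ.le _ (specProj_mem hA _) hep.nonneg]
    refine tau_mono hτ (real_smul_mem (specProj_mem hA _) δ) (cfc_mem hA _)
      (smul_nonneg hδ.le hep.nonneg) ?_
    have h1 := cfc_mul_specProj_of_const (A := A) (a := a + δ) (c := δ) hψc (by
      intro x _ hx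
      simp only [hψ]
      exact min_eq_right ((by linarith : δ ≤ x - a).trans (le_max_left _ _)))
    rw [← he] at h1
    -- Compressing `ψ(A) ≥ 0` to the complement of `e`, where `ψ(A)` acts as `δ` on `e`, leaves
    -- exactly `ψ(A) - δ e`.
    have h2 : star (1 - e) * cfc ψ A * (1 - e) = cfc ψ A - δ • e := by
      rw [hep.one_sub.isSelfAdjoint.star_eq, sub_mul, one_mul, h1.2, mul_sub, mul_one, sub_mul, h1.1,
        smul_mul_assoc, hep.isIdempotentElem.eq]
      abel
    have h3 := star_left_conjugate_nonneg hψ0 (1 - e)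
    rw [h2] at h3
    exact sub_nonneg.1 h3

theorem specProj_eq_zero {A : H →L[ℂ] H} {a : ℝ} (h : ‖A‖ ≤ a) : specProj A a = 0 := by
  have h0 : (1 : H →L[ℂ] H) * excess A a = 0 := by rw [excess_eq_zero h, mul_zero]
  have := mul_rangeProj_eq_zero h0
  rwa [one_mul] at this

theorem setLIntegral_Ioi_add {f : ℝ → ℝ≥0∞} (hf : Antitone f) (a : ℝ) {δ : ℝ} (hδ : 0 < δ) :
    ENNReal.ofReal δ * f (a + δ) + ∫⁻ x in Ioi (a + δ), f x ≤ ∫⁻ x in Ioi a, f x ∧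
    ∫⁻ x in Ioi a, f x ≤ ENNReal.ofReal δ * f a + ∫⁻ x in Ioi (a + δ), f x := by
  have hsplit : ∫⁻ x in Ioi a, f x = (∫⁻ x in Ioc a (a + δ), f x) + ∫⁻ x in Ioi (a + δ), f x := by
    rw [← lintegral_union measurableSet_Ioi, Ioc_union_Ioi_eq_Ioi (by linarith)]
    exact Set.disjoint_left.2 fun x hx hx' => not_lt.2 hx.2 hx'
  have hconst : ∀ c : ℝ≥0∞, ∫⁻ _ in Ioc a (a + δ), c = ENNReal.ofReal δ * c := fun c => by
    rw [setLIntegral_const, Real.volume_Ioc, add_sub_cancel_left, mul_comm]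
  rw [hsplit]
  constructor
  · gcongr
    rw [← hconst]
    exact setLIntegral_mono' measurableSet_Ioc fun x hx => hf hx.2
  · gcongr
    rw [← hconst]
    exact setLIntegral_mono' measurableSet_Ioc fun x hx => hf hx.1.le

/-- Riemann sums with mesh `δ`, summed downwards from a level above `‖A‖`, where everything
vanishes; the shift by `δ` between the two sides is the discretisation error. -/
theorem tau_excess_le_lintegral (hτ : IsFaithfulNormalSemifiniteTrace N τ) {A : H →L[ℂ] H}
    (hA : A ∈ N) {δ : ℝ} (hδ : 0 < δ) (m : ℕ) : ∀ a : ℝ, ‖A‖ ≤ a + m * δ →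
      τ (excess A (a + δ)) ≤ ∫⁻ x in Ioi a, τ (specProj A x) := by
  induction m with
  | zero =>
    intro a ha
    rw [excess_eq_zero (by simp at ha; linarith), tau_zero hτ]
    exact zero_le
  | succ m ih =>
    intro a ha
    refine (tau_excess_add hτ hA (a + δ) hδ).1.trans
      (le_trans ?_ (setLIntegral_Ioi_add (tau_specProj_antitone hτ hA) a hδ).1)
    gcongr
    exact ih (a + δ) (by push_cast at ha; linarith)

theorem lintegral_le_tau_excess (hτ : IsFaithfulNormalSemifiniteTrace N τ) {A : H →L[ℂ] H}
    (hA : A ∈ N) {δ : ℝ} (hδ : 0 < δ) (m : ℕ) : ∀ a : ℝ, ‖A‖ ≤ a + m * δ →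
      ∫⁻ x in Ioi (a + δ), τ (specProj A x) ≤ τ (excess A a) := by
  induction m with
  | zero =>
    intro a ha
    refine le_of_eq_of_le (setLIntegral_eq_zero measurableSet_Ioi fun x hx => ?_) zero_le
    have hx' : a + δ < x := hx
    rw [specProj_eq_zero (by simp at ha; linarith), tau_zero hτ]
    rfl
  | succ m ih =>
    intro a ha
    refine (setLIntegral_Ioi_add (tau_specProj_antitone hτ hA) (a + δ) hδ).2.trans
      (le_trans ?_ (tau_excess_add hτ hA a hδ).2)
    gcongr
    exact ih (a + δ) (by push_cast at ha; linarith)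

/-- Both Riemann estimates are passed to the limit `δ → 0`: one by normality, as `(A-δ)₊` increases
to `A`, the other by monotone convergence on `(δ,∞)`. -/
theorem tau_eq_lintegral_specProj (hτ : IsFaithfulNormalSemifiniteTrace N τ) {A : H →L[ℂ] H}
    (hA : A ∈ N) (hA0 : 0 ≤ A) : τ A = ∫⁻ x in Ioi 0, τ (specProj A x) := by
  have hAs : IsSelfAdjoint A := .of_nonneg hA0
  have hm : ∀ δ : ℝ, 0 < δ → ∃ m : ℕ, ‖A‖ ≤ 0 + m * δ := fun δ hδ => by
    obtain ⟨m, hm⟩ := exists_nat_ge (‖A‖ / δ)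
    exact ⟨m, by rwa [zero_add, ← div_le_iff₀ hδ]⟩
  set ε : ℕ → ℝ := fun n => 1 / ((n : ℝ) + 1) with hε'
  have hε : ∀ n, 0 < ε n := fun n => by positivity
  have hεa : Antitone ε := fun m n hmn => one_div_le_one_div_of_le (by positivity) (by gcongr)
  have hεt : Tendsto ε atTop (𝓝 0) := tendsto_one_div_add_atTop_nhds_zero_nat
  have hspec : ∀ x ∈ spectrum ℝ A, 0 ≤ x := fun x hx => spectrum_nonneg_of_nonneg hA0 hx
  apply le_antisymm
  · refine tau_le_of_isLUB hτ (u := fun n => excess A (ε n)) ?_ (fun n => excess_mem hA _)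
      (fun n => excess_nonneg A _) hA ?_ ?_
    · intro m n hmn
      refine cfc_mono (fun x _ => ?_) (by fun_prop) (by fun_prop)
      have := hεa hmn
      gcongr
    · refine isLUB_of_tendsto (fun n => ?_) (fun v => ?_)
      · conv_rhs => rw [← cfc_id' ℝ A]
        refine cfc_mono (fun x hx => max_le ?_ (hspec x hx)) (by fun_prop) (by fun_prop)
        linarith [hε n]
      · have hn : ∀ n, ‖excess A (ε n) - A‖ ≤ ε n := fun n => by
          have : excess A (ε n) - A = cfc (fun x => max (x - ε n) 0 - x) A := by
            rw [cfc_sub _ _ A (by fun_prop) (by fun_prop), cfc_id' ℝ A, excess]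
          rw [this]
          refine norm_cfc_le (hε n).le fun x hx => ?_
          have h1 := hspec x hx
          have h2 := hε n
          rw [Real.norm_eq_abs, abs_le]
          constructor
          · linarith [le_max_left (x - ε n) 0]
          · have : max (x - ε n) 0 ≤ x := max_le (by linarith) h1
            linarith
        rw [tendsto_iff_norm_sub_tendsto_zero]
        refine squeeze_zero (fun _ => norm_nonneg _) (fun n => ?_)
          (show Tendsto (fun n => ε n * ‖v‖) atTop (𝓝 0) by simpa using hεt.mul_const ‖v‖)
        exact ((excess A (ε n) - A).le_opNorm v).trans
          (mul_le_mul_of_nonneg_right (hn n) (norm_nonneg v))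
    · intro n
      obtain ⟨m, hm⟩ := hm (ε n) (hε n)
      simpa using tau_excess_le_lintegral hτ hA (hε n) m 0 hm
  · have hU : Ioi (0 : ℝ) = ⋃ n, Ioi (ε n) := by
      ext x
      simp only [mem_Ioi, mem_iUnion]
      refine ⟨fun hx => ?_, fun ⟨n, hn⟩ => (hε n).trans hn⟩
      exact (hεt.eventually (gt_mem_nhds hx)).exists
    rw [hU, setLIntegral_iUnion_of_directed]
    · refine iSup_le fun n => ?_
      obtain ⟨m, hm⟩ := hm (ε n) (hε n)
      have := lintegral_le_tau_excess hτ hA (hε n) m 0 hm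
      have he : excess A 0 = A := by
        conv_rhs => rw [← cfc_id' ℝ A]
        exact cfc_congr fun x hx => by simp [hspec x hx]
      rwa [he, zero_add] at this
    · exact (show Monotone fun n => Ioi (ε n) from fun m n hmn =>
        Ioi_subset_Ioi (hεa hmn)).directed_le

theorem lintegral_singularValue (hτ : IsFaithfulNormalSemifiniteTrace N τ) {A : H →L[ℂ] H}
    (hA : A ∈ N) (hA0 : 0 ≤ A) :
    ∫⁻ t in Ioi 0, ENNReal.ofReal (singularValue N τ A t) = τ A := by
  rw [tau_eq_lintegral_specProj hτ hA hA0]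
  have hnn : ∀ᵐ t ∂volume.restrict (Ioi (0 : ℝ)), 0 ≤ singularValue N τ A t :=
    ae_of_all _ fun t => singularValue_nonneg A t
  have hmeas : AEMeasurable (singularValue N τ A) (volume.restrict (Ioi (0 : ℝ))) :=
    (singularValue_antitone hτ A).measurable.aemeasurable
  -- This writes the trace of a spectral projection as the length of a set, to be compared with the
  -- level sets of `μ(·,A)`. Using strict superlevel sets for one inequality and non-strict ones for
  -- the other avoids the endpoints.
  have hvol : ∀ c : ℝ≥0∞, volume {t : ℝ | 0 < t ∧ ENNReal.ofReal t < c} = c := by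
    intro c
    rcases eq_or_ne c ∞ with rfl | hc
    · simp only [ENNReal.ofReal_lt_top, and_true]
      exact Real.volume_Ioi
    · have : {t : ℝ | 0 < t ∧ ENNReal.ofReal t < c} = Ioo 0 c.toReal := by
        ext t
        simp only [mem_ofPred_eq, mem_Ioo]
        refine and_congr_right fun ht => ?_
        rw [ENNReal.ofReal_lt_iff_lt_toReal ht.le hc]
      rw [this, Real.volume_Ioo, sub_zero, ENNReal.ofReal_toReal hc]
  apply le_antisymm
  · rw [lintegral_eq_lintegral_meas_lt _ hnn hmeas]
    refine setLIntegral_mono' measurableSet_Ioi fun a ha => ?_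
    rw [Measure.restrict_apply (measurableSet_lt measurable_const
      (singularValue_antitone hτ A).measurable)]
    conv_rhs => rw [← hvol (τ (specProj A a))]
    refine measure_mono fun t ht => ⟨ht.2, ?_⟩
    by_contra hcon
    exact (not_lt.2 (singularValue_le_of_tau_specProj_le hA hA0 (le_of_lt ha) (not_lt.1 hcon))) ht.1
  · rw [lintegral_eq_lintegral_meas_le _ hnn hmeas]
    refine setLIntegral_mono' measurableSet_Ioi fun a ha => ?_
    rw [Measure.restrict_apply (measurableSet_le measurable_const
      (singularValue_antitone hτ A).measurable)]
    conv_lhs => rw [← hvol (τ (specProj A a))]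
    refine measure_mono fun t ht => ⟨?_, ht.1⟩
    by_contra hcon
    exact (not_le.2 ht.2) (tau_specProj_le_of_singularValue_lt hτ hA hA0 (not_le.1 hcon))

theorem tau_rpow (hτ : IsFaithfulNormalSemifiniteTrace N τ) {A : H →L[ℂ] H}
    (hA : A ∈ N) (hA0 : 0 ≤ A) {p : ℝ} (hp : 0 < p) :
    τ (A ^ p) = ∫⁻ t in Ioi 0, ENNReal.ofReal (singularValue N τ A t ^ p) := by
  rw [← lintegral_singularValue hτ (rpow_mem hA p) CFC.rpow_nonneg]
  simp only [singularValue_rpow hτ hA hA0 hp]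

end ZetaFunctional

namespace ZetaFunctional

/-! ### Majorization of functions -/

/-- A lower set cut to `(0,T]` is an initial interval up to one endpoint, which is null. -/
theorem setLIntegral_le_of_isLowerSet {f g : ℝ → ℝ≥0∞}
    (h : ∀ t, 0 < t → ∫⁻ s in Ioc 0 t, f s ≤ ∫⁻ s in Ioc 0 t, g s) {S : Set ℝ}
    (hS : IsLowerSet S) (T : ℝ) :
    ∫⁻ s in S ∩ Ioc 0 T, f s ≤ ∫⁻ s in S ∩ Ioc 0 T, g s := by
  rcases (S ∩ Ioc 0 T).eq_empty_or_nonempty with he | ⟨x, hx⟩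
  · simp [he]
  have hbdd : BddAbove (S ∩ Ioc 0 T) := ⟨T, fun y hy => hy.2.2⟩
  set c := sSup (S ∩ Ioc 0 T) with hc
  have hc0 : 0 < c := hx.2.1.trans_le (le_csSup hbdd hx)
  have h1 : S ∩ Ioc 0 T ⊆ Ioc 0 c := fun y hy => ⟨hy.2.1, le_csSup hbdd hy⟩
  have h2 : Ioo 0 c ⊆ S ∩ Ioc 0 T := fun y hy => by
    obtain ⟨z, hz, hyz⟩ := exists_lt_of_lt_csSup ⟨x, hx⟩ hy.2
    exact ⟨hS hyz.le hz.1, hy.1, hyz.le.trans hz.2.2⟩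
  calc ∫⁻ s in S ∩ Ioc 0 T, f s ≤ ∫⁻ s in Ioc 0 c, f s := lintegral_mono_set h1
    _ ≤ ∫⁻ s in Ioc 0 c, g s := h c hc0
    _ = ∫⁻ s in Ioo 0 c, g s := setLIntegral_congr Ioo_ae_eq_Ioc.symm
    _ ≤ ∫⁻ s in S ∩ Ioc 0 T, g s := lintegral_mono_set h2

/-- Layer-cake decomposition of the weight: the superlevel sets of a decreasing function are lower
sets, on which the integrals already compare. -/
theorem setLIntegral_antitone_mul_le {f g : ℝ → ℝ≥0∞} (hf : Measurable f) (hg : Measurable g)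
    (h : ∀ t, 0 < t → ∫⁻ s in Ioc 0 t, f s ≤ ∫⁻ s in Ioc 0 t, g s) {w : ℝ → ℝ}
    (hw : Antitone w) (hw0 : ∀ s, 0 ≤ w s) (T : ℝ) :
    ∫⁻ s in Ioc 0 T, f s * ENNReal.ofReal (w s) ≤ ∫⁻ s in Ioc 0 T, g s * ENNReal.ofReal (w s) := by
  have key : ∀ k : ℝ → ℝ≥0∞, Measurable k → ∫⁻ s in Ioc 0 T, k s * ENNReal.ofReal (w s) =
      ∫⁻ a in Ioi (0 : ℝ), ∫⁻ s in {s | a < w s} ∩ Ioc 0 T, k s := by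
    intro k hk
    have hwm : Measurable fun s => ENNReal.ofReal (w s) := hw.measurable.ennreal_ofReal
    rw [show (fun s => k s * ENNReal.ofReal (w s)) = k * fun s => ENNReal.ofReal (w s) from rfl,
      ← lintegral_withDensity_eq_lintegral_mul _ hk hwm,
      lintegral_eq_lintegral_meas_lt _ (ae_of_all _ hw0) hw.measurable.aemeasurable]
    refine lintegral_congr fun a => ?_
    have hm : MeasurableSet {s | a < w s} := measurableSet_lt measurable_const hw.measurable
    rw [withDensity_apply _ hm, Measure.restrict_restrict hm]
  rw [key f hf, key g hg]
  refine lintegral_mono fun a => setLIntegral_le_of_isLowerSet h (fun x y hyx hx => ?_) T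
  exact lt_of_lt_of_le hx (hw hyx)

/-- Write `f^p = f · f^{p-1}` and use the decreasing weight `f^{p-1}` to replace the first factor by
`g`. Young's inequality then gives `I ≤ J/p + I/q`, hence `I ≤ J`. The cut at `T` makes `I` finite,
so that it can be absorbed. -/
theorem setLIntegral_rpow_le_of_majorized {f g : ℝ → ℝ} (hf : Antitone f) (hf0 : ∀ s, 0 ≤ f s)
    (hg : Measurable g) (hg0 : ∀ s, 0 < s → 0 ≤ g s)
    (h : ∀ t, 0 < t → ∫⁻ s in Ioc 0 t, ENNReal.ofReal (f s) ≤ ∫⁻ s in Ioc 0 t, ENNReal.ofReal (g s))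
    {p : ℝ} (hp : 1 < p) (T : ℝ) :
    ∫⁻ s in Ioc 0 T, ENNReal.ofReal (f s ^ p) ≤ ∫⁻ s in Ioc 0 T, ENNReal.ofReal (g s ^ p) := by
  have hp0 : 0 < p := by linarith
  set I := ∫⁻ s in Ioc 0 T, ENNReal.ofReal (f s ^ p) with hI
  set J := ∫⁻ s in Ioc 0 T, ENNReal.ofReal (g s ^ p) with hJ
  have hw : Antitone fun s => f s ^ (p - 1) := fun s t hst =>
    Real.rpow_le_rpow (hf0 t) (hf hst) (by linarith)
  have h1 := setLIntegral_antitone_mul_le hf.measurable.ennreal_ofReal hg.ennreal_ofReal h hw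
    (fun s => Real.rpow_nonneg (hf0 s) _) T
  have h2 : ∫⁻ s in Ioc 0 T, ENNReal.ofReal (f s) * ENNReal.ofReal (f s ^ (p - 1)) = I := by
    refine lintegral_congr fun s => ?_
    rw [← ENNReal.ofReal_mul (hf0 s), ← Real.rpow_one_add' (hf0 s) (by linarith)]
    ring_nf
  set q := p / (p - 1) with hq
  have hpq : p.HolderConjugate q := Real.HolderConjugate.conjExponent hp
  have h3 : ∫⁻ s in Ioc 0 T, ENNReal.ofReal (g s) * ENNReal.ofReal (f s ^ (p - 1)) ≤
      ENNReal.ofReal p⁻¹ * J + ENNReal.ofReal q⁻¹ * I := by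
    rw [hI, hJ, ← lintegral_const_mul _ (hg.pow_const p).ennreal_ofReal,
      ← lintegral_const_mul _ (hf.measurable.pow_const p).ennreal_ofReal,
      ← lintegral_add_left ((hg.pow_const p).ennreal_ofReal.const_mul _)]
    refine setLIntegral_mono' measurableSet_Ioc fun s hs => ?_
    have hgs := hg0 s hs.1
    rw [← ENNReal.ofReal_mul hgs, ← ENNReal.ofReal_mul (inv_nonneg.2 hp0.le),
      ← ENNReal.ofReal_mul (inv_nonneg.2 hpq.symm.nonneg), ← ENNReal.ofReal_add
        (mul_nonneg (inv_nonneg.2 hp0.le) (Real.rpow_nonneg hgs _))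
        (mul_nonneg (inv_nonneg.2 hpq.symm.nonneg) (Real.rpow_nonneg (hf0 s) _))]
    refine ENNReal.ofReal_le_ofReal ?_
    have := Real.young_inequality_of_nonneg hgs (Real.rpow_nonneg (hf0 s) (p - 1)) hpq
    rw [← Real.rpow_mul (hf0 s), show (p - 1) * q = p by
      rw [hq]; exact mul_div_cancel₀ _ (by linarith)] at this
    rwa [div_eq_inv_mul, div_eq_inv_mul] at this
  have hIfin : I ≠ ∞ := by
    refine ne_top_of_le_ne_top ?_ (setLIntegral_mono' (g := fun _ => ENNReal.ofReal (f 0 ^ p))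
      measurableSet_Ioc fun s hs => ENNReal.ofReal_le_ofReal
        (Real.rpow_le_rpow (hf0 s) (hf hs.1.le) hp0.le))
    rw [setLIntegral_const]
    exact ENNReal.mul_ne_top ENNReal.ofReal_ne_top (by simp)
  rcases eq_or_ne J ∞ with hJ' | hJ'
  · rw [hJ']; exact le_top
  rw [h2] at h1
  have h4 := h1.trans h3
  rw [← ENNReal.ofReal_toReal hIfin, ← ENNReal.ofReal_toReal hJ',
    ← ENNReal.ofReal_mul (inv_nonneg.2 hp0.le), ← ENNReal.ofReal_mul (inv_nonneg.2 hpq.symm.nonneg),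
    ← ENNReal.ofReal_add (by positivity) (mul_nonneg (inv_nonneg.2 hpq.symm.nonneg)
      ENNReal.toReal_nonneg), ENNReal.ofReal_le_ofReal_iff (add_nonneg (by positivity)
      (mul_nonneg (inv_nonneg.2 hpq.symm.nonneg) ENNReal.toReal_nonneg))] at h4
  rw [← ENNReal.ofReal_toReal hIfin, ← ENNReal.ofReal_toReal hJ']
  refine ENNReal.ofReal_le_ofReal ?_
  have h5 := hpq.inv_add_inv_eq_one
  have h6 : 0 < p⁻¹ := inv_pos.2 hp0
  have h7 : q⁻¹ = 1 - p⁻¹ := by linarith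
  rw [h7] at h4
  refine le_of_mul_le_mul_left ?_ h6
  linarith

theorem lintegral_rpow_le_of_majorized {f g : ℝ → ℝ} (hf : Antitone f) (hf0 : ∀ s, 0 ≤ f s)
    (hg : Measurable g) (hg0 : ∀ s, 0 < s → 0 ≤ g s)
    (h : ∀ t, 0 < t → ∫⁻ s in Ioc 0 t, ENNReal.ofReal (f s) ≤ ∫⁻ s in Ioc 0 t, ENNReal.ofReal (g s))
    {p : ℝ} (hp : 1 < p) :
    ∫⁻ s in Ioi 0, ENNReal.ofReal (f s ^ p) ≤ ∫⁻ s in Ioi 0, ENNReal.ofReal (g s ^ p) := by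
  have hU : Ioi (0 : ℝ) = ⋃ n : ℕ, Ioc 0 (n : ℝ) := by
    ext x
    simp only [mem_Ioi, mem_iUnion, mem_Ioc]
    refine ⟨fun hx => ?_, fun ⟨n, hn⟩ => hn.1⟩
    obtain ⟨n, hn⟩ := exists_nat_ge x
    exact ⟨n, hx, hn⟩
  conv_lhs => rw [hU]
  rw [setLIntegral_iUnion_of_directed]
  · exact iSup_le fun n => (setLIntegral_rpow_le_of_majorized hf hf0 hg hg0 h hp n).trans
      (lintegral_mono_set Ioc_subset_Ioi_self)
  · exact (show Monotone fun n : ℕ => Ioc (0 : ℝ) n from fun m n hmn =>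
      Ioc_subset_Ioc_right (by exact_mod_cast hmn)).directed_le

end ZetaFunctional

/-! ### Operator convexity of powers -/

namespace ZetaFunctional

/-- The integrand is a positive multiple of an affine function plus a positive multiple of
`(t+x)⁻¹`, which is operator convex. -/
theorem convexOn_cfc_rpowIntegrand₁₂ {A : Type*} [CStarAlgebra A] [PartialOrder A]
    [StarOrderedRing A] (p : ℝ) {t : ℝ} (ht : 0 < t) :
    ConvexOn ℝ (Ici (0 : A)) (cfc (Real.rpowIntegrand₁₂ p t)) := by
  have h₁ : (Ici (0 : A)).EqOn (cfc (Real.rpowIntegrand₁₂ p t))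
      (fun x : A => t ^ (p - 1) • ((t⁻¹ • x + t • Ring.inverse (algebraMap ℝ A t + x)) -
        algebraMap ℝ A 1)) := by
    intro x (hx : 0 ≤ x)
    have hxs : IsSelfAdjoint x := .of_nonneg hx
    have hspectrum : ∀ r ∈ spectrum ℝ x, t + r ≠ 0 := fun r hr =>
      (add_pos_of_pos_of_nonneg ht (spectrum_nonneg_of_nonneg hx hr)).ne'
    have hg : ContinuousOn (fun z : ℝ => (t + z)⁻¹) (spectrum ℝ x) :=
      ContinuousOn.inv₀ (by fun_prop) hspectrum
    have e : Real.rpowIntegrand₁₂ p t =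
        fun z => t ^ (p - 1) * (t⁻¹ * z + t * (t + z)⁻¹ - 1) := rfl
    have e1 : ContinuousOn (fun z : ℝ => t * (t + z)⁻¹) (spectrum ℝ x) := continuousOn_const.mul hg
    have e2 : ContinuousOn (fun z : ℝ => t⁻¹ * z) (spectrum ℝ x) := by fun_prop
    have e3 : ContinuousOn (fun z : ℝ => t⁻¹ * z + t * (t + z)⁻¹) (spectrum ℝ x) := e2.add e1
    have e4 : ContinuousOn (fun z : ℝ => t⁻¹ * z + t * (t + z)⁻¹ - 1) (spectrum ℝ x) :=
      e3.sub continuousOn_const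
    rw [e, cfc_const_mul (t ^ (p - 1)) _ x e4,
      cfc_sub _ _ x e3 continuousOn_const, cfc_add x _ _ e2 e1, cfc_const_mul t⁻¹ _ x,
      cfc_const_mul t _ x hg, cfc_inv _ _ hspectrum, cfc_const_add t _ x, cfc_id' ℝ x,
      cfc_const 1 x]
  refine ConvexOn.congr ?_ h₁.symm
  refine ConvexOn.smul (by positivity) (ConvexOn.sub (ConvexOn.add ?_ ?_)
    (concaveOn_const _ (convex_Ici 0)))
  · exact (convexOn_id (convex_Ici 0)).smul (by positivity)
  · exact (CStarAlgebra.convexOn_ringInverse_algebraMap_add ht).smul ht.le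

/-- `a ↦ a ^ p` is operator convex for `1 < p < 2`. -/
theorem convexOn_rpow {A : Type*} [CStarAlgebra A] [PartialOrder A] [StarOrderedRing A] {p : ℝ}
    (hp : p ∈ Ioo 1 2) : ConvexOn ℝ (Ici (0 : A)) (fun a : A => a ^ p) := by
  lift p to NNReal using by linarith [hp.1]
  have hp' : p ∈ Ioo 1 2 := by exact_mod_cast hp
  simp_rw [← CFC.nnrpow_eq_rpow (zero_lt_one.trans hp'.1)]
  obtain ⟨μ, hμ⟩ := CFC.exists_measure_nnrpow_eq_integral_cfcₙ_rpowIntegrand₁₂ A hp'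
  have h₃' : (Ici 0).EqOn (fun a : A => a ^ p)
      (fun a : A => ∫ t in Ioi 0, cfcₙ (Real.rpowIntegrand₁₂ p t) a ∂μ) :=
    fun a ha => (hμ a ha).2
  refine ConvexOn.congr ?_ h₃'.symm
  refine integral_convexOn_of_integrand_ae (convex_Ici _) ?_ fun a ha => (hμ a ha).1
  filter_upwards [ae_restrict_mem measurableSet_Ioi] with t ht
  refine (convexOn_cfc_rpowIntegrand₁₂ (A := A) p ht).congr fun a ha => ?_
  have ha : 0 ≤ a := ha
  refine (cfcₙ_eq_cfc (hf := ?_) (hf0 := Real.rpowIntegrand₁₂_zero ht)).symm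
  have hs : ∀ z ∈ quasispectrum ℝ a, t + z ≠ 0 := fun z hz =>
    (add_pos_of_pos_of_nonneg ht (quasispectrum_nonneg_of_nonneg a ha z hz)).ne'
  exact continuousOn_const.mul (((by fun_prop : ContinuousOn (fun z : ℝ => t⁻¹ * z) _).add
    (continuousOn_const.mul (ContinuousOn.inv₀ (by fun_prop) hs))).sub continuousOn_const)

theorem rpow_mul_rpow {A : Type*} [CStarAlgebra A] [PartialOrder A] [StarOrderedRing A] {a : A}
    {x y : ℝ} (hx : 0 < x) (hy : 0 < y) : a ^ x * a ^ y = a ^ (x + y) := by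
  lift x to NNReal using hx.le
  lift y to NNReal using hy.le
  have hx' : 0 < x := by exact_mod_cast hx
  have hy' : 0 < y := by exact_mod_cast hy
  rw [← NNReal.coe_add, ← CFC.nnrpow_eq_rpow hx', ← CFC.nnrpow_eq_rpow hy',
    ← CFC.nnrpow_eq_rpow (add_pos hx' hy'), CFC.nnrpow_add hx' hy']

theorem smul_rpow {A : Type*} [CStarAlgebra A] [PartialOrder A] [StarOrderedRing A] {a : A}
    (ha : 0 ≤ a) {c : ℝ} (hc : 0 ≤ c) {p : ℝ} (hp : 0 < p) : (c • a) ^ p = c ^ p • a ^ p := by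
  have has : IsSelfAdjoint a := .of_nonneg ha
  have hcont : Continuous fun x : ℝ => x ^ p := Real.continuous_rpow_const hp.le
  have h1 : c • a = cfc (fun x : ℝ => c * x) a := by
    rw [cfc_const_mul c _ a, cfc_id' ℝ a]
  rw [CFC.rpow_eq_cfc_real (smul_nonneg hc ha), CFC.rpow_eq_cfc_real ha, h1,
    ← cfc_comp' (fun x : ℝ => x ^ p) (fun x => c * x) a (hcont.continuousOn) (by fun_prop),
    ← cfc_smul _ _ a hcont.continuousOn]
  refine cfc_congr fun x hx => ?_
  simp [Real.mul_rpow hc (spectrum_nonneg_of_nonneg ha hx)]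

variable {H : Type*} [NormedAddCommGroup H] [InnerProductSpace ℂ H] [CompleteSpace H]
  {N : VonNeumannAlgebra H} {τ : (H →L[ℂ] H) → ℝ≥0∞}

theorem tau_conj_rpow (hτ : IsFaithfulNormalSemifiniteTrace N τ) {A C : H →L[ℂ] H}
    (hA : A ∈ N) (hA0 : 0 ≤ A) (hC : C ∈ N) {s : ℝ} (hs : 0 < s) :
    τ (C ^ (s / 2) * A * C ^ (s / 2)) = τ (A ^ (1 / 2 : ℝ) * C ^ s * A ^ (1 / 2 : ℝ)) := by
  have hsa : ∀ (X : H →L[ℂ] H) (r : ℝ), star (X ^ r) = X ^ r := fun X r =>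
    (IsSelfAdjoint.of_nonneg CFC.rpow_nonneg).star_eq
  have := hτ.tracial (A ^ (1 / 2 : ℝ) * C ^ (s / 2)) (mul_mem (rpow_mem hA _) (rpow_mem hC _))
  rw [star_mul, hsa, hsa] at this
  convert this using 2
  · rw [mul_assoc, mul_assoc, ← mul_assoc (A ^ (1 / 2 : ℝ)), rpow_mul_rpow (by norm_num) (by norm_num)]
    norm_num [CFC.rpow_one A hA0]
  · rw [mul_assoc, mul_assoc, ← mul_assoc (C ^ (s / 2)), rpow_mul_rpow (by positivity) (by positivity)]
    norm_num

/-- Let `C = A + B`. As `A^s ≤ C^s`, `τ(A^{1+s}) ≤ τ(A^{1/2} C^s A^{1/2}) = τ(C^{s/2} A C^{s/2})`,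
and likewise for `B`; the right-hand sides add up to `τ(C^{1+s})`. -/
theorem tau_rpow_add_tau_rpow_le (hτ : IsFaithfulNormalSemifiniteTrace N τ) {A B : H →L[ℂ] H}
    (hA : A ∈ N) (hA0 : 0 ≤ A) (hB : B ∈ N) (hB0 : 0 ≤ B) {s : ℝ} (hs : 0 < s) (hs1 : s ≤ 1) :
    τ (A ^ (1 + s)) + τ (B ^ (1 + s)) ≤ τ ((A + B) ^ (1 + s)) := by
  set C := A + B with hC
  have hCN : C ∈ N := add_mem hA hB
  have hC0 : 0 ≤ C := add_nonneg hA0 hB0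
  have hsa : ∀ (X : H →L[ℂ] H) (r : ℝ), star (X ^ r) = X ^ r := fun X r =>
    (IsSelfAdjoint.of_nonneg CFC.rpow_nonneg).star_eq
  have hconj : ∀ (X Y : H →L[ℂ] H) (r : ℝ), 0 ≤ X → 0 ≤ Y ^ r * X * Y ^ r := fun X Y r hX => by
    have := star_left_conjugate_nonneg hX (Y ^ r)
    rwa [hsa] at this
  have key : ∀ X ∈ N, 0 ≤ X → X ≤ C → τ (X ^ (1 + s)) ≤ τ (C ^ (s / 2) * X * C ^ (s / 2)) := by
    intro X hX hX0 hXC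
    rw [tau_conj_rpow hτ hX hX0 hCN hs]
    have e : X ^ (1 + s) = X ^ (1 / 2 : ℝ) * X ^ s * X ^ (1 / 2 : ℝ) := by
      rw [rpow_mul_rpow (by norm_num) hs, rpow_mul_rpow (by positivity) (by norm_num)]
      congr 1
      ring
    rw [e]
    refine tau_mono hτ (mul_mem (mul_mem (rpow_mem hX _) (rpow_mem hX _)) (rpow_mem hX _))
      (mul_mem (mul_mem (rpow_mem hX _) (rpow_mem hCN _)) (rpow_mem hX _))
      (hconj _ _ _ CFC.rpow_nonneg) ?_
    have := star_left_conjugate_le_conjugate (CFC.rpow_le_rpow ⟨hs.le, hs1⟩ hXC) (X ^ (1 / 2 : ℝ))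
    rwa [hsa] at this
  have e : C ^ (1 + s) = C ^ (s / 2) * A * C ^ (s / 2) + C ^ (s / 2) * B * C ^ (s / 2) := by
    rw [← add_mul, ← mul_add, ← hC]
    have h1 : C ^ (s / 2) * C * C ^ (s / 2) = C ^ (s / 2) * C ^ (1 : ℝ) * C ^ (s / 2) := by
      rw [CFC.rpow_one C hC0]
    rw [h1, rpow_mul_rpow (by positivity) one_pos, rpow_mul_rpow (by positivity) (by positivity)]
    congr 1
    ring
  have hm : ∀ X ∈ N, C ^ (s / 2) * X * C ^ (s / 2) ∈ N := fun X hX =>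
    mul_mem (mul_mem (rpow_mem hCN _) hX) (rpow_mem hCN _)
  rw [e, hτ.map_add _ (hm A hA) _ (hm B hB) (hconj _ _ _ hA0) (hconj _ _ _ hB0)]
  exact add_le_add (key A hA hA0 (le_add_of_nonneg_right hB0))
    (key B hB hB0 (le_add_of_nonneg_left hA0))

theorem tau_add_rpow_le (hτ : IsFaithfulNormalSemifiniteTrace N τ) {A B : H →L[ℂ] H}
    (hA : A ∈ N) (hA0 : 0 ≤ A) (hB : B ∈ N) (hB0 : 0 ≤ B) {s : ℝ} (hs : 0 < s) (hs1 : s < 1) :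
    τ ((A + B) ^ (1 + s)) ≤ ENNReal.ofReal (2 ^ s) * (τ (A ^ (1 + s)) + τ (B ^ (1 + s))) := by
  have hp : 0 < 1 + s := by linarith
  have h1 := (convexOn_rpow (A := H →L[ℂ] H) (p := 1 + s) ⟨by linarith, by linarith⟩).2 hA0 hB0
    (show (0 : ℝ) ≤ 1 / 2 by norm_num) (show (0 : ℝ) ≤ 1 / 2 by norm_num) (by norm_num)
  have hAp := CFC.rpow_nonneg (a := A) (y := 1 + s)
  have hBp := CFC.rpow_nonneg (a := B) (y := 1 + s)
  have h2 : (A + B) ^ (1 + s) ≤ (2 : ℝ) ^ s • (A ^ (1 + s) + B ^ (1 + s)) := by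
    dsimp only at h1
    rw [← smul_add, ← smul_add, smul_rpow (add_nonneg hA0 hB0) (by norm_num) hp] at h1
    have h3 := smul_le_smul_of_nonneg_left h1 (show (0 : ℝ) ≤ 2 ^ (1 + s) by positivity)
    rw [smul_smul, smul_smul, ← Real.mul_rpow (by norm_num) (by norm_num)] at h3
    convert h3 using 2
    · norm_num
    · rw [Real.rpow_add (by norm_num), Real.rpow_one]; ring
  refine (tau_mono hτ (rpow_mem (add_mem hA hB) _) (real_smul_mem (add_mem (rpow_mem hA _)
    (rpow_mem hB _)) _) CFC.rpow_nonneg h2).trans ?_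
  rw [hτ.map_smul _ (by positivity) _ (add_mem (rpow_mem hA _) (rpow_mem hB _))
    (add_nonneg hAp hBp), hτ.map_add _ (rpow_mem hA _) _ (rpow_mem hB _) hAp hBp]

end ZetaFunctional

namespace ZetaFunctional
variable {H : Type*} [NormedAddCommGroup H] [InnerProductSpace ℂ H] [CompleteSpace H]
  {N : VonNeumannAlgebra H} {τ : (H →L[ℂ] H) → ℝ≥0∞}

/-! ### The Dixmier ideal -/

theorem intervalIntegrable_singularValue (hτ : IsFaithfulNormalSemifiniteTrace N τ)
    (A : H →L[ℂ] H) (a b : ℝ) : IntervalIntegrable (singularValue N τ A) volume a b :=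
  (singularValue_antitone hτ A).intervalIntegrable

theorem mem_dixmierIdeal_iff {A : H →L[ℂ] H} : A ∈ dixmierIdeal N τ ↔
    A ∈ N ∧ ∃ C : ℝ, 1 ≤ C ∧ ∀ t, 0 < t →
      ∫ s in (0 : ℝ)..t, singularValue N τ A s ≤ C * Real.log (1 + t) := by
  have hlog : ∀ t : ℝ, 0 < t → 0 < Real.log (1 + t) := fun t ht => Real.log_pos (by linarith)
  refine and_congr_right fun _ => ⟨fun ⟨C, hC⟩ => ⟨max C 1, le_max_right _ _, fun t ht => ?_⟩,
    fun ⟨C, _, hC⟩ => ⟨C, fun t ht => ?_⟩⟩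
  · have := hC t ht
    rw [one_div, inv_mul_le_iff₀ (hlog t ht), mul_comm] at this
    exact this.trans (mul_le_mul_of_nonneg_right (le_max_left _ _) (hlog t ht).le)
  · rw [one_div, inv_mul_le_iff₀ (hlog t ht), mul_comm]
    exact hC t ht

theorem mem_dixmierIdeal_of_le (hτ : IsFaithfulNormalSemifiniteTrace N τ) {A B : H →L[ℂ] H}
    (hA : A ∈ dixmierIdeal N τ) (hB : B ∈ N) {K : ℝ} (hK : 0 ≤ K)
    (h : ∀ s, singularValue N τ B s ≤ K * singularValue N τ A s) : B ∈ dixmierIdeal N τ := by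
  obtain ⟨-, C, hC⟩ := hA
  refine ⟨hB, K * C, fun t ht => ?_⟩
  have h1 : ∫ s in (0 : ℝ)..t, singularValue N τ B s ≤
      K * ∫ s in (0 : ℝ)..t, singularValue N τ A s := by
    rw [← intervalIntegral.integral_const_mul]
    exact intervalIntegral.integral_mono_on ht.le (intervalIntegrable_singularValue hτ B _ _)
      ((intervalIntegrable_singularValue hτ A _ _).const_mul K) fun s _ => h s
  have h2 : 0 ≤ 1 / Real.log (1 + t) := one_div_nonneg.2 (Real.log_nonneg (by linarith))
  calc 1 / Real.log (1 + t) * ∫ s in (0 : ℝ)..t, singularValue N τ B s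
      ≤ 1 / Real.log (1 + t) * (K * ∫ s in (0 : ℝ)..t, singularValue N τ A s) := by gcongr
    _ = K * (1 / Real.log (1 + t) * ∫ s in (0 : ℝ)..t, singularValue N τ A s) := by ring
    _ ≤ K * C := by gcongr; exact hC t ht

/-- From `μ(s,A+B) ≤ μ(s/2,A) + μ(s/2,B)` by substitution. The factor `2` is harmless, as only
closure of the ideal under sums is at stake. -/
theorem integral_singularValue_add_le (hτ : IsFaithfulNormalSemifiniteTrace N τ)
    (A B : H →L[ℂ] H) {t : ℝ} (ht : 0 ≤ t) :
    ∫ s in (0 : ℝ)..t, singularValue N τ (A + B) s ≤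
      2 * (∫ s in (0 : ℝ)..t, singularValue N τ A s) +
        2 * ∫ s in (0 : ℝ)..t, singularValue N τ B s := by
  have hanti : ∀ C : H →L[ℂ] H, Antitone fun s => singularValue N τ C (s / 2) := fun C s r hsr =>
    singularValue_antitone hτ C (by linarith)
  have hhalf : ∀ C : H →L[ℂ] H, ∫ s in (0 : ℝ)..t, singularValue N τ C (s / 2) ≤
      2 * ∫ s in (0 : ℝ)..t, singularValue N τ C s := fun C => by
    rw [intervalIntegral.integral_comp_div (singularValue N τ C) two_ne_zero, zero_div, smul_eq_mul]
    gcongr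
    exact intervalIntegral.integral_mono_interval le_rfl (by positivity) (by linarith)
      (ae_of_all _ fun s => singularValue_nonneg C s) (intervalIntegrable_singularValue hτ C _ _)
  calc ∫ s in (0 : ℝ)..t, singularValue N τ (A + B) s
      ≤ ∫ s in (0 : ℝ)..t, (singularValue N τ A (s / 2) + singularValue N τ B (s / 2)) := by
        refine intervalIntegral.integral_mono_on ht (intervalIntegrable_singularValue hτ _ _ _)
          ((hanti A).intervalIntegrable.add (hanti B).intervalIntegrable) fun s hs => ?_
        have := singularValue_add_le hτ A B (s := s / 2) (t := s / 2) (by linarith [hs.1])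
          (by linarith [hs.1])
        rwa [add_halves] at this
    _ ≤ _ := by
        rw [intervalIntegral.integral_add (hanti A).intervalIntegrable
          (hanti B).intervalIntegrable]
        exact add_le_add (hhalf A) (hhalf B)

/-- The Dixmier ideal as a linear subspace. -/
noncomputable def dixmierSubmodule (hτ : IsFaithfulNormalSemifiniteTrace N τ) :
    Submodule ℂ (H →L[ℂ] H) where
  carrier := dixmierIdeal N τ
  zero_mem' := by
    refine ⟨zero_mem N, 0, fun t ht => ?_⟩
    have : ∀ s, singularValue N τ (0 : H →L[ℂ] H) s = 0 := fun s =>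
      le_antisymm (by simpa using singularValue_le_norm hτ (0 : H →L[ℂ] H) s)
        (singularValue_nonneg _ s)
    simp [this]
  add_mem' := by
    intro A B hA hB
    rw [mem_dixmierIdeal_iff] at *
    obtain ⟨hAN, C, hC1, hC⟩ := hA
    obtain ⟨hBN, D, hD1, hD⟩ := hB
    refine ⟨add_mem hAN hBN, 2 * C + 2 * D, by linarith, fun t ht => ?_⟩
    have := integral_singularValue_add_le hτ A B ht.le
    have := hC t ht
    have := hD t ht
    linarith
  smul_mem' := fun c A hA => mem_dixmierIdeal_of_le hτ hA (complex_smul_mem hA.1 c)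
    (norm_nonneg c) (singularValue_smul_le hτ c A)

theorem real_smul_mem_dixmierIdeal (hτ : IsFaithfulNormalSemifiniteTrace N τ) {A : H →L[ℂ] H}
    (hA : A ∈ dixmierIdeal N τ) (c : ℝ) : c • A ∈ dixmierIdeal N τ := by
  rw [← Complex.coe_smul]
  exact (dixmierSubmodule hτ).smul_mem _ hA

theorem add_mem_dixmierIdeal (hτ : IsFaithfulNormalSemifiniteTrace N τ) {A B : H →L[ℂ] H}
    (hA : A ∈ dixmierIdeal N τ) (hB : B ∈ dixmierIdeal N τ) : A + B ∈ dixmierIdeal N τ :=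
  (dixmierSubmodule hτ).add_mem hA hB

theorem star_mem_dixmierIdeal (hτ : IsFaithfulNormalSemifiniteTrace N τ) {A : H →L[ℂ] H}
    (hA : A ∈ dixmierIdeal N τ) : star A ∈ dixmierIdeal N τ :=
  mem_dixmierIdeal_of_le hτ hA (star_mem hA.1) zero_le_one fun s => by
    rw [one_mul]; exact singularValue_star_le hτ hA.1 s

theorem realPart_mem_dixmierIdeal (hτ : IsFaithfulNormalSemifiniteTrace N τ) {A : H →L[ℂ] H}
    (hA : A ∈ dixmierIdeal N τ) : (ℜ A : H →L[ℂ] H) ∈ dixmierIdeal N τ := by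
  rw [realPart_apply_coe]
  exact real_smul_mem_dixmierIdeal hτ
    (add_mem_dixmierIdeal hτ hA (star_mem_dixmierIdeal hτ hA)) _

theorem imaginaryPart_mem_dixmierIdeal (hτ : IsFaithfulNormalSemifiniteTrace N τ) {A : H →L[ℂ] H}
    (hA : A ∈ dixmierIdeal N τ) : (ℑ A : H →L[ℂ] H) ∈ dixmierIdeal N τ := by
  rw [imaginaryPart_apply_coe]
  exact (dixmierSubmodule hτ).smul_mem _ (real_smul_mem_dixmierIdeal hτ
    ((dixmierSubmodule hτ).sub_mem hA (star_mem_dixmierIdeal hτ hA)) _)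

theorem star_mul_posPart_add_negPart {X : H →L[ℂ] H} (hX : IsSelfAdjoint X) :
    star X * X = star X⁺ * X⁺ + star X⁻ * X⁻ := by
  have hp : star X⁺ = X⁺ := (IsSelfAdjoint.of_nonneg (CFC.posPart_nonneg X)).star_eq
  have hn : star X⁻ = X⁻ := (IsSelfAdjoint.of_nonneg (CFC.negPart_nonneg X)).star_eq
  rw [hX.star_eq, hp, hn]
  conv_lhs => rw [← CFC.posPart_sub_negPart X hX]
  rw [sub_mul, mul_sub, mul_sub, CFC.posPart_mul_negPart, CFC.negPart_mul_posPart]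
  abel

/-- The positive and negative parts are orthogonal, so `(X⁺)² ≤ X²`, and singular values are
monotone in the square. -/
theorem posPart_mem_dixmierIdeal (hτ : IsFaithfulNormalSemifiniteTrace N τ) {X : H →L[ℂ] H}
    (hX : X ∈ dixmierIdeal N τ) (hXs : IsSelfAdjoint X) : X⁺ ∈ dixmierIdeal N τ :=
  mem_dixmierIdeal_of_le hτ hX (cfcₙ_mem hX.1 _) zero_le_one fun s => by
    rw [one_mul]
    refine singularValue_le_of_star_mul_le hτ ?_ s
    rw [star_mul_posPart_add_negPart hXs]
    exact le_add_of_nonneg_right (star_mul_self_nonneg _)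

theorem negPart_mem_dixmierIdeal (hτ : IsFaithfulNormalSemifiniteTrace N τ) {X : H →L[ℂ] H}
    (hX : X ∈ dixmierIdeal N τ) (hXs : IsSelfAdjoint X) : X⁻ ∈ dixmierIdeal N τ := by
  rw [← CFC.posPart_neg]
  exact posPart_mem_dixmierIdeal hτ ((dixmierSubmodule hτ).neg_mem hX) hXs.neg

/-! ### Traces of powers of operators in the Dixmier ideal -/

theorem ofReal_intervalIntegral_eq {f : ℝ → ℝ} {t : ℝ} (ht : 0 ≤ t)
    (hf : IntervalIntegrable f volume 0 t) (hf0 : ∀ s, 0 < s → 0 ≤ f s) :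
    ENNReal.ofReal (∫ s in (0 : ℝ)..t, f s) = ∫⁻ s in Ioc 0 t, ENNReal.ofReal (f s) := by
  rw [intervalIntegral.integral_of_le ht, ofReal_integral_eq_lintegral_ofReal
    ((intervalIntegrable_iff_integrableOn_Ioc_of_le ht).1 hf)]
  filter_upwards [ae_restrict_mem measurableSet_Ioc] with s hs
  exact hf0 s hs.1

theorem intervalIntegrable_div_one_add (C : ℝ) {t : ℝ} (ht : 0 ≤ t) :
    IntervalIntegrable (fun u => C / (1 + u)) volume 0 t := by
  refine ContinuousOn.intervalIntegrable (continuousOn_const.div (by fun_prop) fun u hu => ?_)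
  rw [uIcc_of_le ht] at hu
  linarith [hu.1]

theorem integral_div_one_add (C : ℝ) {t : ℝ} (ht : 0 ≤ t) :
    ∫ u in (0 : ℝ)..t, C / (1 + u) = C * Real.log (1 + t) := by
  have hd : ∀ u ∈ uIcc 0 t, HasDerivAt (fun u => C * Real.log (1 + u)) (C / (1 + u)) u := by
    intro u hu
    rw [uIcc_of_le ht] at hu
    have h1 : HasDerivAt (fun u : ℝ => 1 + u) 1 u := (hasDerivAt_id u).const_add 1
    refine ((h1.log (by linarith [hu.1])).const_mul C).congr_deriv ?_
    ring
  rw [intervalIntegral.integral_eq_sub_of_hasDerivAt hd (intervalIntegrable_div_one_add C ht)]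
  simp

theorem lintegral_div_one_add_rpow {C s : ℝ} (hC : 0 ≤ C) (hs : 0 < s) :
    ∫⁻ u in Ioi 0, ENNReal.ofReal ((C / (1 + u)) ^ (1 + s)) = ENNReal.ofReal (C ^ (1 + s) / s) := by
  have hnn : ∀ u ∈ Ioi (0 : ℝ), 0 ≤ (C / (1 + u)) ^ (1 + s) := fun u hu => by
    have : (0 : ℝ) < u := hu
    positivity
  have hd : ∀ u ∈ Ici (0 : ℝ), HasDerivAt (fun u => -(C ^ (1 + s) / s) * (1 + u) ^ (-s))
      ((C / (1 + u)) ^ (1 + s)) u := by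
    intro u hu
    have hu0 : (0 : ℝ) ≤ u := hu
    have h1 : HasDerivAt (fun u : ℝ => 1 + u) 1 u := (hasDerivAt_id u).const_add 1
    refine ((h1.rpow_const (p := -s) (Or.inl (by positivity))).const_mul
      (-(C ^ (1 + s) / s))).congr_deriv ?_
    rw [Real.div_rpow hC (by positivity), show -s - 1 = -(1 + s) by ring,
      Real.rpow_neg (by positivity)]
    field_simp
  have hlim : Tendsto (fun u : ℝ => -(C ^ (1 + s) / s) * (1 + u) ^ (-s)) atTop (𝓝 0) := by
    have h1 : Tendsto (fun u : ℝ => 1 + u) atTop atTop := tendsto_atTop_add_const_left _ _ tendsto_id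
    have := ((tendsto_rpow_neg_atTop hs).comp h1).const_mul (-(C ^ (1 + s) / s))
    simpa using this
  have hint := integrableOn_Ioi_deriv_of_nonneg' hd hnn hlim
  rw [← ofReal_integral_eq_lintegral_ofReal hint, integral_Ioi_of_hasDerivAt_of_nonneg' hd hnn hlim]
  · simp
  · filter_upwards [ae_restrict_mem measurableSet_Ioi] with u hu using hnn u hu

/-- Since `C log(1+t)` is the integral of `C/(1+u)` over `(0,t)`, membership in the ideal is a
majorization by this function, whose `(1+s)`-th power integrates to `C^{1+s}/s`. -/
theorem exists_tau_rpow_le (hτ : IsFaithfulNormalSemifiniteTrace N τ) {A : H →L[ℂ] H}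
    (hA : A ∈ dixmierIdeal N τ) (hA0 : 0 ≤ A) :
    ∃ C : ℝ, 1 ≤ C ∧ ∀ s, 0 < s → τ (A ^ (1 + s)) ≤ ENNReal.ofReal (C ^ (1 + s) / s) := by
  obtain ⟨hAN, C, hC1, hC⟩ := mem_dixmierIdeal_iff.1 hA
  have hC0 : 0 ≤ C := by linarith
  refine ⟨C, hC1, fun s hs => ?_⟩
  rw [tau_rpow hτ hAN hA0 (by linarith), ← lintegral_div_one_add_rpow hC0 hs]
  have hnn : ∀ u : ℝ, 0 < u → 0 ≤ C / (1 + u) := fun u hu => by positivity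
  refine lintegral_rpow_le_of_majorized (singularValue_antitone hτ A)
    (singularValue_nonneg A) (by fun_prop) hnn (fun t ht => ?_) (by linarith)
  rw [← ofReal_intervalIntegral_eq ht.le (intervalIntegrable_singularValue hτ A _ _)
      fun u _ => singularValue_nonneg A u,
    ← ofReal_intervalIntegral_eq ht.le (intervalIntegrable_div_one_add C ht.le) hnn,
    integral_div_one_add C ht.le]
  exact ENNReal.ofReal_le_ofReal (hC t ht)

theorem tau_rpow_lt_top (hτ : IsFaithfulNormalSemifiniteTrace N τ) {A : H →L[ℂ] H}
    (hA : A ∈ dixmierIdeal N τ) (hA0 : 0 ≤ A) {s : ℝ} (hs : 0 < s) : τ (A ^ (1 + s)) < ∞ := by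
  obtain ⟨C, -, hC⟩ := exists_tau_rpow_le hτ hA hA0
  exact (hC s hs).trans_lt ENNReal.ofReal_lt_top

theorem tau_rpow_le_of_majorized (hτ : IsFaithfulNormalSemifiniteTrace N τ) {A B : H →L[ℂ] H}
    (hA : A ∈ N) (hA0 : 0 ≤ A) (hB : B ∈ N) (hB0 : 0 ≤ B) (h : Majorized N τ B A) {p : ℝ}
    (hp : 1 < p) : τ (B ^ p) ≤ τ (A ^ p) := by
  rw [tau_rpow hτ hA hA0 (by linarith), tau_rpow hτ hB hB0 (by linarith)]
  refine lintegral_rpow_le_of_majorized (singularValue_antitone hτ B) (singularValue_nonneg B)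
    (singularValue_antitone hτ A).measurable (fun s _ => singularValue_nonneg A s)
    (fun t ht => ?_) hp
  rw [← ofReal_intervalIntegral_eq ht.le (intervalIntegrable_singularValue hτ A _ _)
      fun u _ => singularValue_nonneg A u,
    ← ofReal_intervalIntegral_eq ht.le (intervalIntegrable_singularValue hτ B _ _)
      fun u _ => singularValue_nonneg B u]
  exact ENNReal.ofReal_le_ofReal (h t ht.le)

/-! ### The zeta function -/

theorem zetaFun_nonneg (A : H →L[ℂ] H) (t : Ioi (0 : ℝ)) : 0 ≤ zetaFun τ A t :=
  mul_nonneg (one_div_nonneg.2 (le_of_lt t.2)) ENNReal.toReal_nonneg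

/-- The singular value formula turns the trace into an integral of a jointly measurable function, so
Tonelli applies. -/
theorem measurable_zetaFun (hτ : IsFaithfulNormalSemifiniteTrace N τ) {A : H →L[ℂ] H}
    (hA : A ∈ N) (hA0 : 0 ≤ A) : Measurable (zetaFun τ A) := by
  have h1 : zetaFun τ A = fun t : Ioi (0 : ℝ) => 1 / (t : ℝ) *
      (∫⁻ s in Ioi 0, ENNReal.ofReal (singularValue N τ A s ^ (1 + 1 / (t : ℝ)))).toReal := by
    ext t
    have : (0 : ℝ) < t := t.2
    rw [zetaFun, tau_rpow hτ hA hA0 (by positivity)]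
  rw [h1]
  have h2 : Measurable fun x : Ioi (0 : ℝ) × ℝ =>
      ENNReal.ofReal (singularValue N τ A x.2 ^ (1 + 1 / (x.1 : ℝ))) := by
    refine Measurable.ennreal_ofReal (Measurable.pow
      ((singularValue_antitone hτ A).measurable.comp measurable_snd) ?_)
    fun_prop
  have h3 := h2.lintegral_prod_right' (ν := volume.restrict (Ioi (0 : ℝ)))
  exact Measurable.mul (by fun_prop) h3.ennreal_toReal

theorem exists_zetaFun_le (hτ : IsFaithfulNormalSemifiniteTrace N τ) {A : H →L[ℂ] H}
    (hA : A ∈ dixmierIdeal N τ) (hA0 : 0 ≤ A) :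
    ∃ C : ℝ, 0 ≤ C ∧ ∀ t : Ioi (0 : ℝ), 1 ≤ (t : ℝ) → zetaFun τ A t ≤ C := by
  obtain ⟨C, hC1, hC⟩ := exists_tau_rpow_le hτ hA hA0
  refine ⟨C ^ (2 : ℝ), by positivity, fun t ht => ?_⟩
  have ht0 : (0 : ℝ) < t := t.2
  have h1 := ENNReal.toReal_mono ENNReal.ofReal_ne_top (hC (1 / t) (by positivity))
  rw [ENNReal.toReal_ofReal (by positivity)] at h1
  calc zetaFun τ A t ≤ 1 / (t : ℝ) * (C ^ (1 + 1 / (t : ℝ)) / (1 / (t : ℝ))) :=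
        mul_le_mul_of_nonneg_left h1 (by positivity)
    _ = C ^ (1 + 1 / (t : ℝ)) := by field_simp
    _ ≤ C ^ (2 : ℝ) := by
        refine Real.rpow_le_rpow_of_exponent_le hC1 ?_
        have : 1 / (t : ℝ) ≤ 1 := by rw [div_le_one ht0]; exact ht
        linarith

theorem indicator_zetaFun_mem (hτ : IsFaithfulNormalSemifiniteTrace N τ) {A : H →L[ℂ] H}
    (hA : A ∈ dixmierIdeal N τ) (hA0 : 0 ≤ A) :
    indicator {t : Ioi (0 : ℝ) | 1 ≤ (t : ℝ)} (zetaFun τ A) ∈ LInfty := by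
  obtain ⟨C, hC0, hC⟩ := exists_zetaFun_le hτ hA hA0
  refine ⟨((measurable_zetaFun hτ hA.1 hA0).indicator
    (measurableSet_le measurable_const measurable_subtype_coe)).aemeasurable, C, fun t => ?_⟩
  by_cases ht : 1 ≤ (t : ℝ)
  · rw [indicator_of_mem (show t ∈ {t : Ioi (0 : ℝ) | 1 ≤ (t : ℝ)} from ht),
      abs_of_nonneg (zetaFun_nonneg A t)]
    exact hC t ht
  · rw [indicator_of_notMem (show t ∉ {t : Ioi (0 : ℝ) | 1 ≤ (t : ℝ)} from ht), abs_zero]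
    exact hC0

theorem eventually_gt_coe_atTop (c : ℝ) : ∀ᶠ t : Ioi (0 : ℝ) in atTop, c < (t : ℝ) :=
  (tendsto_comp_val_Ioi_atTop (f := id)).2 tendsto_id |>.eventually_gt_atTop c

theorem indicator_zetaFun_eventuallyEq (τ : (H →L[ℂ] H) → ℝ≥0∞) (A : H →L[ℂ] H) :
    indicator {t : Ioi (0 : ℝ) | 1 ≤ (t : ℝ)} (zetaFun τ A) =ᶠ[atTop] zetaFun τ A := by
  filter_upwards [eventually_gt_coe_atTop 1] with t ht
  exact indicator_of_mem (show t ∈ {t : Ioi (0 : ℝ) | 1 ≤ (t : ℝ)} from ht.le) _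

variable {γ : LInfty →ₗ[ℝ] ℝ}

theorem IsGeneralisedLimit.eq_of_tendsto (hγ : IsGeneralisedLimit γ) {z w : LInfty}
    (h : Tendsto (fun t => z.1 t - w.1 t) atTop (𝓝 0)) : γ z = γ w := by
  have := hγ.vanish (z - w) h
  rwa [map_sub, sub_eq_zero] at this

/-- Any representative up to `o(1)` may be used; this yields independence of the cut-off as well as
additivity and homogeneity. -/
theorem zetaPos_eq (hτ : IsFaithfulNormalSemifiniteTrace N τ) (hγ : IsGeneralisedLimit γ)
    {A : H →L[ℂ] H} (hA : A ∈ dixmierIdeal N τ) (hA0 : 0 ≤ A) {z : LInfty}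
    (hz : Tendsto (fun t => z.1 t - zetaFun τ A t) atTop (𝓝 0)) : zetaPos τ γ A = γ z := by
  rw [zetaPos, dif_pos (indicator_zetaFun_mem hτ hA hA0)]
  refine (hγ.eq_of_tendsto (hz.congr' ?_)).symm
  filter_upwards [indicator_zetaFun_eventuallyEq τ A] with t ht
  rw [ht]

theorem exists_zetaPos_eq (hτ : IsFaithfulNormalSemifiniteTrace N τ) (γ : LInfty →ₗ[ℝ] ℝ)
    {A : H →L[ℂ] H} (hA : A ∈ dixmierIdeal N τ) (hA0 : 0 ≤ A) :
    ∃ z : LInfty, z.1 =ᶠ[atTop] zetaFun τ A ∧ zetaPos τ γ A = γ z :=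
  ⟨⟨_, indicator_zetaFun_mem hτ hA hA0⟩, indicator_zetaFun_eventuallyEq τ A, by
    rw [zetaPos, dif_pos (indicator_zetaFun_mem hτ hA hA0)]⟩

theorem tendsto_rpow_one_div {c : ℝ} (hc : 0 < c) :
    Tendsto (fun t : Ioi (0 : ℝ) => c ^ (1 / (t : ℝ))) atTop (𝓝 1) := by
  have h1 : Tendsto (fun t : ℝ => c ^ (1 / t)) atTop (𝓝 1) := by
    have h2 : Tendsto (fun t : ℝ => 1 / t) atTop (𝓝 0) := by
      simpa using tendsto_inv_atTop_zero (𝕜 := ℝ)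
    have := (Real.continuousAt_const_rpow hc.ne' (b := 0)).tendsto.comp h2
    simpa [Function.comp_def] using this
  exact tendsto_comp_val_Ioi_atTop.2 h1

theorem zetaPos_add (hτ : IsFaithfulNormalSemifiniteTrace N τ) (hγ : IsGeneralisedLimit γ)
    {A B : H →L[ℂ] H} (hA : A ∈ dixmierIdeal N τ) (hA0 : 0 ≤ A) (hB : B ∈ dixmierIdeal N τ)
    (hB0 : 0 ≤ B) : zetaPos τ γ (A + B) = zetaPos τ γ A + zetaPos τ γ B := by
  have hAB := add_mem_dixmierIdeal hτ hA hB
  have hAB0 := add_nonneg hA0 hB0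
  obtain ⟨z, hz, hzA⟩ := exists_zetaPos_eq hτ γ hA hA0
  obtain ⟨w, hw, hwB⟩ := exists_zetaPos_eq hτ γ hB hB0
  rw [hzA, hwB, ← map_add]
  refine zetaPos_eq hτ hγ hAB hAB0 ?_
  obtain ⟨C, -, hC⟩ := exists_zetaFun_le hτ hA hA0
  obtain ⟨D, -, hD⟩ := exists_zetaFun_le hτ hB hB0
  -- The difference of the sum of the zeta functions of `A` and `B` and that of `A + B` is at most
  -- `0` by superadditivity, and at least this quantity, `C + D` bounding the sum.
  have hlim : Tendsto (fun t : Ioi (0 : ℝ) => (1 - (2 : ℝ) ^ (1 / (t : ℝ))) * (C + D)) atTop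
      (𝓝 0) := by
    simpa using ((tendsto_rpow_one_div two_pos).const_sub 1).mul_const (C + D)
  refine tendsto_of_tendsto_of_tendsto_of_le_of_le' hlim tendsto_const_nhds ?_ ?_
  · filter_upwards [hz, hw, eventually_gt_coe_atTop 1] with t htz htw ht
    have ht0 : (0 : ℝ) < t := t.2
    have hs0 : 0 < 1 / (t : ℝ) := by positivity
    have hs1 : 1 / (t : ℝ) < 1 := by rwa [div_lt_one ht0]
    have hfin := ENNReal.add_ne_top.2 ⟨(tau_rpow_lt_top hτ hA hA0 hs0).ne,
      (tau_rpow_lt_top hτ hB hB0 hs0).ne⟩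
    have h1 := ENNReal.toReal_mono (ENNReal.mul_ne_top ENNReal.ofReal_ne_top hfin)
      (tau_add_rpow_le hτ hA.1 hA0 hB.1 hB0 hs0 hs1)
    rw [ENNReal.toReal_mul, ENNReal.toReal_ofReal (by positivity),
      ENNReal.toReal_add (tau_rpow_lt_top hτ hA hA0 hs0).ne
        (tau_rpow_lt_top hτ hB hB0 hs0).ne] at h1
    have h2 : zetaFun τ (A + B) t ≤ 2 ^ (1 / (t : ℝ)) * (zetaFun τ A t + zetaFun τ B t) := by
      have := mul_le_mul_of_nonneg_left h1 hs0.le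
      simp only [zetaFun]
      linarith
    have h3 : (1 : ℝ) ≤ 2 ^ (1 / (t : ℝ)) := Real.one_le_rpow (by norm_num) hs0.le
    have h4 := hC t ht.le
    have h5 := hD t ht.le
    rw [Submodule.coe_add, Pi.add_apply, htz, htw]
    nlinarith
  · filter_upwards [hz, hw, eventually_gt_coe_atTop 1] with t htz htw ht
    have ht0 : (0 : ℝ) < t := t.2
    have hs0 : 0 < 1 / (t : ℝ) := by positivity
    have hs1 : 1 / (t : ℝ) ≤ 1 := by rw [div_le_one ht0]; exact ht.le
    have h1 := ENNReal.toReal_mono (tau_rpow_lt_top hτ hAB hAB0 hs0).ne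
      (tau_rpow_add_tau_rpow_le hτ hA.1 hA0 hB.1 hB0 hs0 hs1)
    rw [ENNReal.toReal_add (tau_rpow_lt_top hτ hA hA0 hs0).ne
        (tau_rpow_lt_top hτ hB hB0 hs0).ne] at h1
    have := mul_le_mul_of_nonneg_left h1 hs0.le
    rw [Submodule.coe_add, Pi.add_apply, htz, htw]
    simp only [zetaFun]
    linarith

theorem zetaPos_zero (hτ : IsFaithfulNormalSemifiniteTrace N τ) (hγ : IsGeneralisedLimit γ) :
    zetaPos τ γ (0 : H →L[ℂ] H) = 0 := by
  have h := zetaPos_add hτ hγ (dixmierSubmodule hτ).zero_mem le_rfl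
    (dixmierSubmodule hτ).zero_mem le_rfl
  rw [add_zero] at h
  linarith

theorem zetaPos_smul (hτ : IsFaithfulNormalSemifiniteTrace N τ) (hγ : IsGeneralisedLimit γ)
    {A : H →L[ℂ] H} (hA : A ∈ dixmierIdeal N τ) (hA0 : 0 ≤ A) {c : ℝ} (hc : 0 ≤ c) :
    zetaPos τ γ (c • A) = c * zetaPos τ γ A := by
  rcases hc.eq_or_lt with rfl | hc
  · rw [zero_smul, zero_mul, zetaPos_zero hτ hγ]
  obtain ⟨z, hz, hzA⟩ := exists_zetaPos_eq hτ γ hA hA0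
  rw [hzA, ← smul_eq_mul, ← map_smul]
  refine zetaPos_eq hτ hγ (real_smul_mem_dixmierIdeal hτ hA c) (smul_nonneg hc.le hA0) ?_
  obtain ⟨C, hC0, hC⟩ := exists_zetaFun_le hτ hA hA0
  have hlim : Tendsto (fun t : Ioi (0 : ℝ) => |c - c * c ^ (1 / (t : ℝ))| * C) atTop (𝓝 0) := by
    simpa using ((((tendsto_rpow_one_div hc).const_mul c).const_sub c).abs).mul_const C
  refine squeeze_zero_norm' ?_ hlim
  filter_upwards [hz, eventually_gt_coe_atTop 1] with t htz ht
  have ht0 : (0 : ℝ) < t := t.2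
  have hp : 0 < 1 + 1 / (t : ℝ) := by positivity
  have h1 : zetaFun τ (c • A) t = c * c ^ (1 / (t : ℝ)) * zetaFun τ A t := by
    rw [zetaFun, smul_rpow hA0 hc.le hp, hτ.map_smul _ (by positivity) _ (rpow_mem hA.1 _)
      CFC.rpow_nonneg, ENNReal.toReal_mul, ENNReal.toReal_ofReal (by positivity),
      Real.rpow_add hc, Real.rpow_one, zetaFun]
    ring
  rw [Submodule.coe_smul, Pi.smul_apply, htz, h1, smul_eq_mul, ← sub_mul, norm_mul,
    Real.norm_eq_abs, Real.norm_of_nonneg (zetaFun_nonneg A t)]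
  gcongr
  exact hC t ht.le

theorem zetaPos_le_of_majorized (hτ : IsFaithfulNormalSemifiniteTrace N τ)
    (hγ : IsGeneralisedLimit γ) {A B : H →L[ℂ] H} (hA : A ∈ dixmierIdeal N τ) (hA0 : 0 ≤ A)
    (hB : B ∈ dixmierIdeal N τ) (hB0 : 0 ≤ B) (h : Majorized N τ B A) :
    zetaPos τ γ B ≤ zetaPos τ γ A := by
  rw [zetaPos, zetaPos, dif_pos (indicator_zetaFun_mem hτ hA hA0),
    dif_pos (indicator_zetaFun_mem hτ hB hB0), ← sub_nonneg, ← map_sub]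
  refine hγ.nonneg _ fun t => sub_nonneg.2 (indicator_le_indicator ?_)
  have ht0 : (0 : ℝ) < t := t.2
  refine mul_le_mul_of_nonneg_left (ENNReal.toReal_mono
    (tau_rpow_lt_top hτ hA hA0 (by positivity)).ne
    (tau_rpow_le_of_majorized hτ hA.1 hA0 hB.1 hB0 h ?_)) (by positivity)
  have : 0 < 1 / (t : ℝ) := by positivity
  linarith

/-! ### The linear extension -/

/-- The real linear extension of the zeta functional to self-adjoint operators. -/
noncomputable def zetaReal (τ : (H →L[ℂ] H) → ℝ≥0∞) (γ : LInfty →ₗ[ℝ] ℝ) (X : H →L[ℂ] H) : ℝ :=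
  zetaPos τ γ X⁺ - zetaPos τ γ X⁻

theorem zeta_eq (τ : (H →L[ℂ] H) → ℝ≥0∞) (γ : LInfty →ₗ[ℝ] ℝ) (A : H →L[ℂ] H) :
    zeta τ γ A = (zetaReal τ γ (ℜ A) : ℂ) + Complex.I * (zetaReal τ γ (ℑ A) : ℂ) := by
  simp only [zeta, zetaReal, Complex.ofReal_sub]

/-- For `X = P - Q`, additivity on positive operators applied to `X⁺ + Q = P + X⁻` shows that the
decomposition does not matter. -/
theorem zetaReal_sub (hτ : IsFaithfulNormalSemifiniteTrace N τ) (hγ : IsGeneralisedLimit γ)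
    {P Q : H →L[ℂ] H} (hP : P ∈ dixmierIdeal N τ) (hP0 : 0 ≤ P) (hQ : Q ∈ dixmierIdeal N τ)
    (hQ0 : 0 ≤ Q) : zetaReal τ γ (P - Q) = zetaPos τ γ P - zetaPos τ γ Q := by
  have hX : P - Q ∈ dixmierIdeal N τ := (dixmierSubmodule hτ).sub_mem hP hQ
  have hXs : IsSelfAdjoint (P - Q) := (IsSelfAdjoint.of_nonneg hP0).sub (.of_nonneg hQ0)
  have h1 : (P - Q)⁺ + Q = P + (P - Q)⁻ := by
    have := CFC.posPart_sub_negPart (P - Q) hXs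
    rw [sub_eq_sub_iff_add_eq_add] at this
    exact this
  have h2 := congrArg (zetaPos τ γ) h1
  rw [zetaPos_add hτ hγ (posPart_mem_dixmierIdeal hτ hX hXs) (CFC.posPart_nonneg _) hQ hQ0,
    zetaPos_add hτ hγ hP hP0 (negPart_mem_dixmierIdeal hτ hX hXs) (CFC.negPart_nonneg _)] at h2
  rw [zetaReal]
  linarith

theorem zetaReal_add (hτ : IsFaithfulNormalSemifiniteTrace N τ) (hγ : IsGeneralisedLimit γ)
    {X Y : H →L[ℂ] H} (hX : X ∈ dixmierIdeal N τ) (hXs : IsSelfAdjoint X)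
    (hY : Y ∈ dixmierIdeal N τ) (hYs : IsSelfAdjoint Y) :
    zetaReal τ γ (X + Y) = zetaReal τ γ X + zetaReal τ γ Y := by
  have h1 : X + Y = (X⁺ + Y⁺) - (X⁻ + Y⁻) := by
    conv_lhs => rw [← CFC.posPart_sub_negPart X hXs, ← CFC.posPart_sub_negPart Y hYs]
    abel
  have hXp := posPart_mem_dixmierIdeal hτ hX hXs
  have hXn := negPart_mem_dixmierIdeal hτ hX hXs
  have hYp := posPart_mem_dixmierIdeal hτ hY hYs
  have hYn := negPart_mem_dixmierIdeal hτ hY hYs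
  have p0 := fun Z : H →L[ℂ] H => CFC.posPart_nonneg Z
  have n0 := fun Z : H →L[ℂ] H => CFC.negPart_nonneg Z
  rw [h1, zetaReal_sub hτ hγ (add_mem_dixmierIdeal hτ hXp hYp) (add_nonneg (p0 X) (p0 Y))
    (add_mem_dixmierIdeal hτ hXn hYn) (add_nonneg (n0 X) (n0 Y)),
    zetaPos_add hτ hγ hXp (p0 X) hYp (p0 Y), zetaPos_add hτ hγ hXn (n0 X) hYn (n0 Y),
    zetaReal, zetaReal]
  ring

theorem zetaReal_smul (hτ : IsFaithfulNormalSemifiniteTrace N τ) (hγ : IsGeneralisedLimit γ)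
    {X : H →L[ℂ] H} (hX : X ∈ dixmierIdeal N τ) (hXs : IsSelfAdjoint X) (c : ℝ) :
    zetaReal τ γ (c • X) = c * zetaReal τ γ X := by
  have hXp := posPart_mem_dixmierIdeal hτ hX hXs
  have hXn := negPart_mem_dixmierIdeal hτ hX hXs
  have p0 := CFC.posPart_nonneg X
  have n0 := CFC.negPart_nonneg X
  rcases le_total 0 c with hc | hc
  · rw [zetaReal, CFC.posPart_smul_of_nonneg hc, CFC.negPart_smul_of_nonneg hc,
      zetaPos_smul hτ hγ hXp p0 hc, zetaPos_smul hτ hγ hXn n0 hc, zetaReal]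
    ring
  · have hc' : 0 ≤ -c := neg_nonneg.2 hc
    rw [zetaReal, CFC.posPart_smul_of_nonpos hc, CFC.negPart_smul_of_nonpos hc,
      zetaPos_smul hτ hγ hXn n0 hc', zetaPos_smul hτ hγ hXp p0 hc', zetaReal]
    ring

theorem zeta_of_nonneg (hτ : IsFaithfulNormalSemifiniteTrace N τ) (hγ : IsGeneralisedLimit γ)
    {A : H →L[ℂ] H} (hA0 : 0 ≤ A) : zeta τ γ A = (zetaPos τ γ A : ℂ) := by
  have hAs : IsSelfAdjoint A := .of_nonneg hA0
  have hre : (ℜ A : H →L[ℂ] H) = A := hAs.coe_realPart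
  have him : (ℑ A : H →L[ℂ] H) = 0 := by rw [hAs.imaginaryPart]; rfl
  rw [zeta_eq, hre, him, zetaReal, zetaReal, (CFC.posPart_eq_self A).2 hA0,
    (CFC.negPart_eq_zero_iff A hAs).2 hA0, CFC.posPart_zero, CFC.negPart_zero]
  simp [zetaPos_zero hτ hγ]

/-- The zeta functional as a linear functional on the Dixmier ideal. -/
noncomputable def zetaLinear (hτ : IsFaithfulNormalSemifiniteTrace N τ)
    (hγ : IsGeneralisedLimit γ) : dixmierSubmodule hτ →ₗ[ℂ] ℂ where
  toFun A := zeta τ γ (A : H →L[ℂ] H)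
  map_add' A B := by
    have hr := fun C : dixmierSubmodule hτ => realPart_mem_dixmierIdeal hτ C.2
    have hi := fun C : dixmierSubmodule hτ => imaginaryPart_mem_dixmierIdeal hτ C.2
    simp only [zeta_eq, Submodule.coe_add, map_add, AddSubgroup.coe_add]
    rw [zetaReal_add hτ hγ (hr A) (ℜ (A : H →L[ℂ] H)).2 (hr B) (ℜ (B : H →L[ℂ] H)).2,
      zetaReal_add hτ hγ (hi A) (ℑ (A : H →L[ℂ] H)).2 (hi B) (ℑ (B : H →L[ℂ] H)).2]
    push_cast
    ring
  map_smul' c A := by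
    have hr := realPart_mem_dixmierIdeal hτ A.2
    have hi := imaginaryPart_mem_dixmierIdeal hτ A.2
    have hrs := (ℜ (A : H →L[ℂ] H)).2
    have his := (ℑ (A : H →L[ℂ] H)).2
    have hsa : ∀ (r : ℝ) {X : H →L[ℂ] H}, IsSelfAdjoint X → IsSelfAdjoint (r • X) :=
      fun r X hX => (IsSelfAdjoint.all r).smul hX
    simp only [zeta_eq, Submodule.coe_smul, realPart_smul, imaginaryPart_smul, AddSubgroup.coe_add,
      AddSubgroup.coe_sub, selfAdjoint.val_smul, RingHom.id_apply, smul_eq_mul]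
    -- The real part of `c • A` is a difference of real multiples; moving the sign into the scalar
    -- lets additivity and real homogeneity handle it.
    rw [sub_eq_add_neg, ← neg_smul, zetaReal_add hτ hγ (real_smul_mem_dixmierIdeal hτ hr _)
        (hsa _ hrs) (real_smul_mem_dixmierIdeal hτ hi _) (hsa _ his),
      zetaReal_add hτ hγ (real_smul_mem_dixmierIdeal hτ hi _)
        (hsa _ his) (real_smul_mem_dixmierIdeal hτ hr _) (hsa _ hrs),
      zetaReal_smul hτ hγ hr hrs, zetaReal_smul hτ hγ hr hrs, zetaReal_smul hτ hγ hi his,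
      zetaReal_smul hτ hγ hi his]
    apply Complex.ext
    · simp [sub_eq_add_neg]
    · simp

end ZetaFunctional

/-! ### The main theorem -/

theorem mainTheorem5 {H : Type*} [NormedAddCommGroup H] [InnerProductSpace ℂ H] [CompleteSpace H]
    (N : VonNeumannAlgebra H) (τ : (H →L[ℂ] H) → ℝ≥0∞)
    (hτ : ZetaFunctional.IsFaithfulNormalSemifiniteTrace N τ)
    (γ : ZetaFunctional.LInfty →ₗ[ℝ] ℝ) (hγ : ZetaFunctional.IsGeneralisedLimit γ) :
    -- the four positive parts of an operator in the ideal lie in the ideal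
    (∀ A ∈ ZetaFunctional.dixmierIdeal N τ,
      (ℜ A : H →L[ℂ] H)⁺ ∈ ZetaFunctional.dixmierIdeal N τ ∧
      (ℜ A : H →L[ℂ] H)⁻ ∈ ZetaFunctional.dixmierIdeal N τ ∧
      (ℑ A : H →L[ℂ] H)⁺ ∈ ZetaFunctional.dixmierIdeal N τ ∧
      (ℑ A : H →L[ℂ] H)⁻ ∈ ZetaFunctional.dixmierIdeal N τ) ∧
    -- on positive operators the functional is well defined and given by the formula
    (∀ A ∈ ZetaFunctional.dixmierIdeal N τ, 0 ≤ A →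
      (∀ t : ℝ, 0 < t → τ (A ^ (1 + 1 / t)) < ∞) ∧
      (∃ z : ZetaFunctional.LInfty, z.1 =ᶠ[atTop] ZetaFunctional.zetaFun τ A) ∧
      ∀ z : ZetaFunctional.LInfty, z.1 =ᶠ[atTop] ZetaFunctional.zetaFun τ A →
        ZetaFunctional.zeta τ γ A = (γ z : ℂ)) ∧
    -- the functional is linear and fully symmetric on the ideal
    ∃ (S : Submodule ℂ (H →L[ℂ] H)) (φ : S →ₗ[ℂ] ℂ),
      (S : Set (H →L[ℂ] H)) = ZetaFunctional.dixmierIdeal N τ ∧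
      (∀ A : S, φ A = ZetaFunctional.zeta τ γ (A : H →L[ℂ] H)) ∧
      ZetaFunctional.IsFullySymmetric N τ φ := by
  refine ⟨fun A hA => ?_, fun A hA hA0 => ⟨fun t ht => ?_, ?_, fun z hz => ?_⟩,
    ZetaFunctional.dixmierSubmodule hτ, ZetaFunctional.zetaLinear hτ hγ, rfl, fun _ => rfl, ?_⟩
  · have hr := ZetaFunctional.realPart_mem_dixmierIdeal hτ hA
    have hi := ZetaFunctional.imaginaryPart_mem_dixmierIdeal hτ hA
    exact ⟨ZetaFunctional.posPart_mem_dixmierIdeal hτ hr (ℜ A).2,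
      ZetaFunctional.negPart_mem_dixmierIdeal hτ hr (ℜ A).2,
      ZetaFunctional.posPart_mem_dixmierIdeal hτ hi (ℑ A).2,
      ZetaFunctional.negPart_mem_dixmierIdeal hτ hi (ℑ A).2⟩
  · exact ZetaFunctional.tau_rpow_lt_top hτ hA hA0 (one_div_pos.2 ht)
  · exact ⟨⟨_, ZetaFunctional.indicator_zetaFun_mem hτ hA hA0⟩,
      ZetaFunctional.indicator_zetaFun_eventuallyEq τ A⟩
  · rw [ZetaFunctional.zeta_of_nonneg hτ hγ hA0, ZetaFunctional.zetaPos_eq hτ hγ hA hA0]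
    refine tendsto_const_nhds.congr' ?_
    filter_upwards [hz] with t ht
    rw [ht, sub_self]
  · intro A B hA0 hB0 h
    change ZetaFunctional.zeta τ γ (B : H →L[ℂ] H) ≤ ZetaFunctional.zeta τ γ (A : H →L[ℂ] H)
    rw [ZetaFunctional.zeta_of_nonneg hτ hγ hA0, ZetaFunctional.zeta_of_nonneg hτ hγ hB0]
    exact Complex.real_le_real.2
      (ZetaFunctional.zetaPos_le_of_majorized hτ hγ A.2 hA0 B.2 hB0 h)
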